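/- Let $a:(0,1]\to[0,\infty]$ be a (Borel measurable) function such that (i) for every $\epsilon>0$ there is $c(\epsilon)>0$ with $a(r)\ge c(\epsilon)$ and $a(r)^{-1}\ge c(\epsilon)$ for all $r\in(0,1]$ with $r>\epsilon$; (ii) $\int_0^1 \frac{a(r)}{r}\,dr<\infty$ and $\int_0^1\frac{r}{a(r)}\,dr<\infty$; (iii) there is a constant $K>0$ such that $\frac1{\epsilon^2}\int_0^\epsilon a(r)^{-1}\,r\int_0^r\frac{a(s)}{s}\,ds\,dr<K$ for all $\epsilon\in(0,1)$. Define $\rho:\mathbb R^2\to[0,\infty]$ by $\rho(x)=a(|x|)^{-1}$ if $|x|<1$ and $x_1x_2>0$, $\rho(x)=a(|x|)$ if $|x|<1$ and $x_1x_2<0$, and $\rho(x)=1$ otherwise, and let $\mu(dx)=\rho(x)\,dx$. Let $$\mathcal W=\Big\{u\in W^{1,1}_{\mathrm{loc}}(\mathbb R^2):\int_{\mathbb R^2}(|u|^2+|\nabla u|^2)\,d\mu<\infty\Big\},\qquad \mathcal E(u,v)=\int_{\mathbb R^2}\nabla u\cdot\nabla v\,d\mu,$$ let $\mathcal E_\alpha(u,v)=\mathcal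 E(u,v)+\alpha\langle u,v\rangle_{L^2(\mu)}$, and let $\mathcal H$ be the closure of $C_0^\infty(\mathbb R^2)$ (smooth functions with compact support) in $(\mathcal W,\mathcal E_1)$. Then $\mu$ is a Radon measure with full support, and the following hold. (1) $(\mathcal E,\mathcal H)$ is a Dirichlet form on $L^2(\mathbb R^2,\mu)$: $\mathcal H$ is a dense linear subspace of $L^2(\mathbb R^2,\mu)$, $\mathcal E$ is a non-negative symmetric bilinear form on $\mathcal H$, $\mathcal H$ is complete with respect to $\mathcal E_1$, and for each $u\in\mathcal H$ the function $v=(0\vee u)\wedge1$ is in $\mathcal H$ with $\mathcal E(v,v)\le\mathcal E(u,u)$. (2) It is regular: there is a set of compactly supported continuous functions that belong to $\mathcal H$ which is dense in $\mathcal H$ with respect to $\mathcal E_1$, and dense in the space of all compactly supported continuous functions with respect to the uniform norm. (3) It is strongly local: $\mathcal E(u,v)=0$ whenever $u,v\in\mathcal H$ have compact support and $v$ is constant on a neighbourhood of the support of $u$. (4) It is recurrent: let $(T_t)_{t\ge0}$ be the strongly continuous symmetric contraction semigroup on $L^2(\mathbb R^2,\mu)$ associated with $(\mathcal E,\mathcal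 H)$, that is, the one for which $G_\alpha f=\int_0^\infty e^{-\alpha t}T_tf\,dt$ satisfies $G_\alpha f\in\mathcal H$ and $\mathcal E_\alpha(G_\alpha f,v)=\langle f,v\rangle$ for all $\alpha>0$, $f\in L^2(\mathbb R^2,\mu)$, $v\in\mathcal H$. This semigroup exists and, for every non-negative $f\in L^1(\mathbb R^2,\mu)$, the potential $Gf=\lim_{N\to\infty}\int_0^NT_sf\,ds$ satisfies $Gf(x)\in\{0,\infty\}$ for $\mu$-almost every $x$. (Here, and in (5), $T_t$ is extended to non-negative measurable functions by monotone limits.) (5) It is conservative: $T_t1=1$ $\mu$-almost everywhere, for every $t>0$. -/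

import Mathlib

open MeasureTheory Set Filter Topology
open scoped ENNReal NNReal CompactlySupported

noncomputable section

/-! ### Symmetric forms on `L²(X, μ)`

A form is a pair `(D, B)`: a domain `D ⊆ L²(X, μ)` and a function `B` of two variables, of which
only the values on `D × D` matter. -/

section Forms

variable {X : Type*} [TopologicalSpace X] [MeasurableSpace X] {μ : Measure X}

/-- `B_α(u, v) = B(u, v) + α ⟨u, v⟩`. -/
def formShift (B : Lp ℝ 2 μ → Lp ℝ 2 μ → ℝ) (α : ℝ) (u v : Lp ℝ 2 μ) : ℝ :=
  B u v + α * inner ℝ u v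

/-- `(B, D)` is a symmetric form: `D` is a dense linear subspace of `L²` and `B` is bilinear,
symmetric and non-negative on `D`. -/
structure IsSymmetricForm (D : Set (Lp ℝ 2 μ)) (B : Lp ℝ 2 μ → Lp ℝ 2 μ → ℝ) : Prop where
  zero_mem : (0 : Lp ℝ 2 μ) ∈ D
  add_mem : ∀ u ∈ D, ∀ v ∈ D, u + v ∈ D
  smul_mem : ∀ c : ℝ, ∀ u ∈ D, c • u ∈ D
  dense : Dense D
  symm : ∀ u ∈ D, ∀ v ∈ D, B u v = B v u
  add_left : ∀ u ∈ D, ∀ v ∈ D, ∀ w ∈ D, B (u + v) w = B u w + B v w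
  smul_left : ∀ c : ℝ, ∀ u ∈ D, ∀ v ∈ D, B (c • u) v = c * B u v
  nonneg : ∀ u ∈ D, 0 ≤ B u u

/-- `D` is complete for the metric given by `B₁`. -/
def IsClosedForm (D : Set (Lp ℝ 2 μ)) (B : Lp ℝ 2 μ → Lp ℝ 2 μ → ℝ) : Prop :=
  ∀ u : ℕ → Lp ℝ 2 μ, (∀ n, u n ∈ D) →
    (∀ ε > 0, ∃ N, ∀ m ≥ N, ∀ n ≥ N, formShift B 1 (u m - u n) (u m - u n) < ε) →
    ∃ v ∈ D, Tendsto (fun n => formShift B 1 (u n - v) (u n - v)) atTop (𝓝 0)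

/-- The unit contraction `(0 ∨ u) ∧ 1` operates on the form. -/
def IsMarkovianForm (D : Set (Lp ℝ 2 μ)) (B : Lp ℝ 2 μ → Lp ℝ 2 μ → ℝ) : Prop :=
  ∀ u ∈ D, ∃ v ∈ D, (∀ᵐ x ∂μ, v x = min (max 0 (u x)) 1) ∧ B v v ≤ B u u

/-- A Dirichlet form: a closed Markovian symmetric form. -/
structure IsDirichletForm (D : Set (Lp ℝ 2 μ)) (B : Lp ℝ 2 μ → Lp ℝ 2 μ → ℝ) : Prop where
  symmetric : IsSymmetricForm D B
  closed : IsClosedForm D B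
  markovian : IsMarkovianForm D B

/-- A core: a set of compactly supported continuous functions belonging to `D`, which is dense in
`D` for `B₁` and dense in `C_c(X)` for the uniform norm. -/
structure IsCoreOfForm (D : Set (Lp ℝ 2 μ)) (B : Lp ℝ 2 μ → Lp ℝ 2 μ → ℝ)
    (C : Set C_c(X, ℝ)) : Prop where
  subset_domain : ∀ φ ∈ C, ∃ w ∈ D, w =ᵐ[μ] φ
  dense_domain : ∀ u ∈ D, ∀ ε > 0, ∃ φ ∈ C, ∃ w ∈ D, w =ᵐ[μ] φ ∧
    formShift B 1 (u - w) (u - w) < ε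
  dense_uniform : ∀ f : C_c(X, ℝ), ∀ ε > 0, ∃ φ ∈ C, ∀ x, |f x - φ x| < ε

/-- A form is regular if it possesses a core. -/
def IsRegularForm (D : Set (Lp ℝ 2 μ)) (B : Lp ℝ 2 μ → Lp ℝ 2 μ → ℝ) : Prop :=
  ∃ C : Set C_c(X, ℝ), IsCoreOfForm D B C

/-- `supp[u]`: the support of the measure `|u| dμ`. -/
def L2supp (u : Lp ℝ 2 μ) : Set X :=
  (μ.withDensity fun x => ‖u x‖ₑ).support

/-- Strong locality: `B(u, v) = 0` whenever `u, v ∈ D` have compact support and `v` is constant on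
a neighbourhood of `supp[u]`. -/
def IsStronglyLocalForm (D : Set (Lp ℝ 2 μ)) (B : Lp ℝ 2 μ → Lp ℝ 2 μ → ℝ) : Prop :=
  ∀ u ∈ D, ∀ v ∈ D, IsCompact (L2supp u) → IsCompact (L2supp v) →
    (∃ U : Set X, IsOpen U ∧ L2supp u ⊆ U ∧ ∃ c : ℝ, ∀ᵐ x ∂μ, x ∈ U → v x = c) →
    B u v = 0

/-! ### The semigroup of a form, recurrence and conservativeness -/

/-- `(T_t)_{t ≥ 0}` is the strongly continuous symmetric contraction semigroup on `L²` associated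
with the closed form `(B, D)`: its resolvent `G_α f = ∫₀^∞ e^{-αt} T_t f dt` takes values in `D`
and `B_α(G_α f, v) = ⟨f, v⟩` for all `v ∈ D`. Only the values `T t` with `t ≥ 0` matter. -/
structure IsSemigroupOfForm (D : Set (Lp ℝ 2 μ)) (B : Lp ℝ 2 μ → Lp ℝ 2 μ → ℝ)
    (T : ℝ → Lp ℝ 2 μ →L[ℝ] Lp ℝ 2 μ) : Prop where
  zero : T 0 = ContinuousLinearMap.id ℝ (Lp ℝ 2 μ)
  add : ∀ s ≥ 0, ∀ t ≥ 0, T (s + t) = (T s).comp (T t)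
  contraction : ∀ t ≥ 0, ‖T t‖ ≤ 1
  symm : ∀ t ≥ 0, ∀ f g : Lp ℝ 2 μ, inner ℝ (T t f) g = inner ℝ f (T t g)
  continuous : ∀ f : Lp ℝ 2 μ, Tendsto (fun t => T t f) (𝓝[>] 0) (𝓝 f)
  resolvent_mem : ∀ α > 0, ∀ f : Lp ℝ 2 μ, ∫ t in Ioi (0 : ℝ), Real.exp (-α * t) • T t f ∈ D
  resolvent_eq : ∀ α > 0, ∀ f : Lp ℝ 2 μ, ∀ v ∈ D,
    formShift B α (∫ t in Ioi (0 : ℝ), Real.exp (-α * t) • T t f) v = inner ℝ f v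

open Classical in
/-- The class in `L²(X, μ)` of a square integrable function (and `0` for any other function). -/
def toL2 (μ : Measure X) (f : X → ℝ) : Lp ℝ 2 μ :=
  if h : MemLp f 2 μ then h.toLp f else 0

/-- The bounded functions `(f ∧ n) 1_{K_n}`, where `K_n` is an increasing sequence of compact sets
with union `X`. They increase to `f`, and they are square integrable when `f` is measurable and
`μ` is finite on compact sets. -/
def cutoff [SigmaCompactSpace X] (f : X → ℝ≥0) (n : ℕ) : X → ℝ :=
  (compactCovering X n).indicator fun x => ((min (f x) n : ℝ≥0) : ℝ)

/-- The extension by monotone limits of a positivity preserving operator on `L²` to non-negative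
measurable functions; on integrable functions and on bounded functions this is the usual extension
of a Markovian operator to `L¹` and to `L^∞`. -/
def extendMonotone [SigmaCompactSpace X] (S : Lp ℝ 2 μ →L[ℝ] Lp ℝ 2 μ) (f : X → ℝ≥0) (x : X) :
    ℝ≥0∞ :=
  ⨆ n : ℕ, ENNReal.ofReal (S (toL2 μ (cutoff f n)) x)

/-- The potential `G f = lim_{N → ∞} ∫₀^N T_s f ds` of a non-negative measurable function, for a
positivity preserving semigroup `T`. -/
def potential [SigmaCompactSpace X] (T : ℝ → Lp ℝ 2 μ →L[ℝ] Lp ℝ 2 μ) (f : X → ℝ≥0) (x : X) :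
    ℝ≥0∞ :=
  ⨆ N : ℕ, ⨆ n : ℕ, ENNReal.ofReal ((∫ s in (0 : ℝ)..N, T s (toL2 μ (cutoff f n))) x)

/-- The form is recurrent: it has an associated semigroup, and for it `G f ∈ {0, ∞}` almost
everywhere, for every non-negative `f ∈ L¹(μ)`. -/
def IsRecurrentForm [SigmaCompactSpace X] (D : Set (Lp ℝ 2 μ))
    (B : Lp ℝ 2 μ → Lp ℝ 2 μ → ℝ) : Prop :=
  (∃ T, IsSemigroupOfForm D B T) ∧
  ∀ T, IsSemigroupOfForm D B T → ∀ f : X → ℝ≥0, Measurable f → ∫⁻ x, f x ∂μ < ⊤ →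
    ∀ᵐ x ∂μ, potential T f x = 0 ∨ potential T f x = ⊤

/-- The form is conservative: it has an associated semigroup, and for it `T_t 1 = 1` almost
everywhere, for every `t > 0`. -/
def IsConservativeForm [SigmaCompactSpace X] (D : Set (Lp ℝ 2 μ))
    (B : Lp ℝ 2 μ → Lp ℝ 2 μ → ℝ) : Prop :=
  (∃ T, IsSemigroupOfForm D B T) ∧
  ∀ T, IsSemigroupOfForm D B T → ∀ t > 0, ∀ᵐ x ∂μ, extendMonotone (T t) (fun _ => 1) x = 1

end Forms

/-! ### Weighted Sobolev spaces on the plane -/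

/-- The Euclidean plane. -/
abbrev Plane : Type := EuclideanSpace ℝ (Fin 2)

/-- Smooth functions with compact support. -/
def IsTestFunction (φ : Plane → ℝ) : Prop :=
  ContDiff ℝ (⊤ : ℕ∞) φ ∧ HasCompactSupport φ

/-- `u ∈ W^{1,1}_loc` with weak gradient `g`. -/
structure HasWeakGradient (u : Plane → ℝ) (g : Plane → Plane) : Prop where
  locallyIntegrable : LocallyIntegrable u volume
  locallyIntegrable_grad : LocallyIntegrable g volume
  integral_eq : ∀ φ, IsTestFunction φ → ∀ e : Plane,
    ∫ x, u x * fderiv ℝ φ x e = -∫ x, inner ℝ (g x) e * φ x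

open Classical in
/-- A weak gradient of `u` (it is unique up to null sets when it exists). -/
def weakGradient (u : Plane → ℝ) : Plane → Plane :=
  if h : ∃ g, HasWeakGradient u g then h.choose else 0

/-- `E(u, v) = ∫ ∇u · ∇v dμ`. -/
def energy (μ : Measure Plane) (u v : Lp ℝ 2 μ) : ℝ :=
  ∫ x, inner ℝ (weakGradient u x) (weakGradient v x) ∂μ

/-- The weighted Sobolev space `W`: all `u ∈ W^{1,1}_loc` with `∫ (|u|² + |∇u|²) dμ < ∞`. -/
def sobolevW (μ : Measure Plane) : Set (Lp ℝ 2 μ) :=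
  {u | ∃ g, HasWeakGradient u g ∧ MemLp g 2 μ}

/-- The space `H`: the closure in `W`, with respect to `E₁`, of the test functions. -/
def sobolevH (μ : Measure Plane) : Set (Lp ℝ 2 μ) :=
  {u | u ∈ sobolevW μ ∧ ∀ ε > 0, ∃ φ, IsTestFunction φ ∧ ∃ w ∈ sobolevW μ, w =ᵐ[μ] φ ∧
    formShift (energy μ) 1 (u - w) (u - w) < ε}

/-! ### The weight -/

/-- The assumptions on the profile `a : (0, 1] → [0, ∞]`; values of `a` outside `(0, 1]` are
irrelevant. -/
structure IsZhikovProfile (a : ℝ → ℝ≥0∞) : Prop where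
  measurable : Measurable ((Ioc (0 : ℝ) 1).domRestrict a)
  nondegenerate : ∀ ε > 0, ∃ c : ℝ, 0 < c ∧ ∀ r ∈ Ioc (0 : ℝ) 1, ε < r →
    ENNReal.ofReal c ≤ a r ∧ ENNReal.ofReal c ≤ (a r)⁻¹
  integrable_div : ∫⁻ r in Ioc (0 : ℝ) 1, a r / ENNReal.ofReal r < ⊤
  integrable_inv : ∫⁻ r in Ioc (0 : ℝ) 1, ENNReal.ofReal r / a r < ⊤
  rank_one : ∃ K : ℝ, 0 < K ∧ ∀ ε ∈ Ioo (0 : ℝ) 1,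
    (∫⁻ r in Ioc (0 : ℝ) ε, (a r)⁻¹ * ENNReal.ofReal r *
      ∫⁻ s in Ioc (0 : ℝ) r, a s / ENNReal.ofReal s) / ENNReal.ofReal (ε ^ 2) < ENNReal.ofReal K

open Classical in
/-- The weight: in the unit disc it is `1 / a(|x|)` in the open first and third quadrants and
`a(|x|)` in the open second and fourth quadrants; it is `1` elsewhere. -/
def zhikovWeight (a : ℝ → ℝ≥0∞) (x : Plane) : ℝ≥0∞ :=
  if 0 < x 0 * x 1 ∧ ‖x‖ < 1 then (a ‖x‖)⁻¹
  else if x 0 * x 1 < 0 ∧ ‖x‖ < 1 then a ‖x‖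
  else 1

/-- The measure `μ = ρ dx`. -/
def zhikovMeasure (a : ℝ → ℝ≥0∞) : Measure Plane :=
  volume.withDensity (zhikovWeight a)

end

/-!
# Dirichlet forms with discontinuous weights on the plane

Let `ρ` be a positive finite weight on the plane such that `ρ` and `1 / ρ` are locally integrable
(`IsAdmissibleWeight`), and let `μ = ρ dx`. By the Cauchy–Schwarz inequality, convergence in
`L²(μ)` implies convergence in `L¹_loc(dx)`, so being a weak gradient is a closed condition on pairs
`(u, g)` in `L²(μ)` (`IsAdmissibleWeight.isClosed_hasWeakGradient`). Hence the space `H` with the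
inner product `E₁` is the Hilbert space `energyDomain ρ`, the closure of the pairs `(φ, ∇φ)` with
`φ` a test function (`IsAdmissibleWeight.isFormOf`). Closedness and regularity follow at once, and
strong locality holds because the weak gradient of `u` vanishes on every open set where `u` is
constant. For the Markov property, the unit contraction is approximated by smooth functions with
slopes at most `1`; the corresponding truncations of test functions are bounded in the Hilbert space
and converge in `L²`, so a weak limit (`IsEnergySpace.exists_of_tendsto`) has the required energy.

The semigroup of the form is obtained from its resolvent, which exists by coercivity
(`IsEnergySpace.exists_resolventMap`), through Yosida approximations
(`IsContractionResolvent.exists_semigroup`).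

Recurrence and conservativeness are consequences of a unit approximation (`IsUnitApproximation`):
functions `uₙ ∈ H` with values in `[0, 1]` which are eventually `1` on every compact set and whose
energies tend to `0`. For a weight which is at most `1` off the unit disc, smoothed cutoff functions
of `log (1 + |x|²) / n` have energies of order `1 / n`, exactly as for the Lebesgue measure
(`IsAdmissibleWeight.exists_isUnitApproximation`).

For recurrence, let `f ≥ 0` and let `A` be contained in a compact set and such that the potential of
`f` is bounded on `A`. The restriction `g` of `R₁ f` to `A` has energy integrals `⟪g, R_α g⟫` which
stay bounded as `α → 0`, so `⟪g, q⟫` is bounded by a multiple of the square root of the energy of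
`q ∈ H`; with `q = uₙ` this gives `∫_A R₁ f dμ = 0`. Hence `R₁ f`, and with it the whole potential,
vanishes wherever the potential is finite (`IsFormOf.resolvent_eq_zero_of_bounded`). For
conservativeness, `⟪1_K - T_t 1_K, uₙ⟫` is the energy pairing of `uₙ` with the time integral of
`T_s 1_K` and tends to `0`, so `T_t` preserves the integral of `1_K` for every compact set `K`; by
symmetry of `T_t` this forces `T_t 1 = 1` (`IsFormOf.isConservativeForm`).

The weight of the theorem is admissible because `∫ a(r) r dr` and `∫ r / a(r) dr` are finite on
`(0, 1]` (`IsZhikovProfile.isAdmissibleWeight`).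
-/
noncomputable section

/-! ### Contraction semigroups and their resolvents -/

section Semigroups

variable {E : Type*} [NormedAddCommGroup E] [NormedSpace ℝ E]

/-- A strongly continuous contraction semigroup; only the values `T t` with `t ≥ 0` matter. -/
structure IsContractionSemigroup (T : ℝ → E →L[ℝ] E) : Prop where
  zero : T 0 = ContinuousLinearMap.id ℝ E
  add : ∀ s ≥ 0, ∀ t ≥ 0, T (s + t) = (T s).comp (T t)
  contraction : ∀ t ≥ 0, ‖T t‖ ≤ 1
  continuous : ∀ f : E, Tendsto (fun t => T t f) (𝓝[>] 0) (𝓝 f)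

/-- A strongly continuous contraction resolvent; only the values `G α` with `α > 0` matter. -/
structure IsContractionResolvent (G : ℝ → E →L[ℝ] E) : Prop where
  identity : ∀ α > 0, ∀ β > 0, ∀ f, G α f - G β f = (β - α) • G α (G β f)
  norm_le : ∀ α > 0, ∀ f, ‖α • G α f‖ ≤ ‖f‖
  tendsto : ∀ f, Tendsto (fun α : ℝ => α • G α f) atTop (𝓝 f)

/-- The resolvent `G` is the Laplace transform of the semigroup `T`. -/
def IsLaplaceTransform (T G : ℝ → E →L[ℝ] E) : Prop :=
  ∀ α > 0, ∀ f, ∫ t in Ioi (0 : ℝ), Real.exp (-α * t) • T t f = G α f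

/-- The Yosida approximation `λ (λ G_λ - 1)` of the generator of the resolvent `G`. -/
def yosida (G : ℝ → E →L[ℝ] E) (l : ℝ) : E →L[ℝ] E := l • (l • G l - 1)

lemma yosida_apply (G : ℝ → E →L[ℝ] E) (l : ℝ) (f : E) :
    yosida G l f = l • (l • G l f - f) := rfl

/-- A closed convex set contains the infinite convex combinations of its elements. -/
lemma Convex.hasSum_smul_mem {M : Set E} (hM : Convex ℝ M) (hc : IsClosed M) {w : ℕ → ℝ}
    (hw : ∀ k, 0 ≤ w k) (hw1 : HasSum w 1) {z : ℕ → E} (hz : ∀ k, z k ∈ M) {x : E}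
    (hx : HasSum (fun k => w k • z k) x) : x ∈ M := by
  have h1 : Tendsto (fun n => (∑ k ∈ Finset.range n, w k)⁻¹ • ∑ k ∈ Finset.range n, w k • z k)
      atTop (𝓝 x) := by
    have := (hw1.tendsto_sum_nat.inv₀ one_ne_zero).smul hx.tendsto_sum_nat
    simpa using this
  refine hc.mem_of_tendsto h1 ?_
  filter_upwards [hw1.tendsto_sum_nat.eventually_const_lt zero_lt_one] with n hn
  exact hM.centerMass_mem (fun i _ => hw i) hn (fun i _ => hz i)

/-- Contractions which converge strongly on a dense set converge strongly. -/
lemma tendsto_apply_of_dense {ι : Type*} {l : Filter ι} {S : ι → E →L[ℝ] E} {S₀ : E →L[ℝ] E}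
    {D : Set E} (hD : Dense D) (hS : ∀ᶠ j in l, ∀ f, ‖S j f‖ ≤ ‖f‖) (hS₀ : ∀ f, ‖S₀ f‖ ≤ ‖f‖)
    (h : ∀ u ∈ D, Tendsto (fun j => S j u) l (𝓝 (S₀ u))) (f : E) :
    Tendsto (fun j => S j f) l (𝓝 (S₀ f)) := by
  rw [Metric.tendsto_nhds]
  intro ε hε
  obtain ⟨u, hu, huf⟩ := Metric.mem_closure_iff.1 (hD f) (ε / 3) (by positivity)
  filter_upwards [hS, Metric.tendsto_nhds.1 (h u hu) (ε / 3) (by positivity)] with j hj hju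
  rw [dist_eq_norm] at huf hju ⊢
  have h1 : S j f - S₀ f = S j (f - u) + (S j u - S₀ u) - S₀ (f - u) := by
    simp only [map_sub]; abel
  rw [h1]
  have := norm_sub_le (S j (f - u) + (S j u - S₀ u)) (S₀ (f - u))
  have := norm_add_le (S j (f - u)) (S j u - S₀ u)
  linarith [hj (f - u), hS₀ (f - u)]

namespace IsContractionResolvent

variable {G : ℝ → E →L[ℝ] E} (hG : IsContractionResolvent G)
include hG

lemma dense_range {α : ℝ} (hα : 0 < α) : Dense (range (G α)) := by
  intro f
  refine mem_closure_of_tendsto (hG.tendsto f) ?_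
  filter_upwards [eventually_gt_atTop 0] with l hl
  refine ⟨l • (f + (α - l) • G l f), ?_⟩
  have := hG.identity α hα l hl f
  rw [map_smul, map_add, map_smul]
  congr 1
  rw [show α - l = -(l - α) by ring, neg_smul, ← this]
  abel

lemma comm {α β : ℝ} (hα : 0 < α) (hβ : 0 < β) (f : E) : G α (G β f) = G β (G α f) := by
  rcases eq_or_ne α β with rfl | hne
  · rfl
  have h1 := hG.identity α hα β hβ f
  have h2 := hG.identity β hβ α hα f
  have h3 : (β - α) • (G α (G β f) - G β (G α f)) = 0 := by
    rw [smul_sub, ← h1, show β - α = -(α - β) by ring, neg_smul, ← h2]; abel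
  rcases smul_eq_zero.1 h3 with h | h
  · exact absurd (sub_eq_zero.1 h).symm hne
  · exact sub_eq_zero.1 h

lemma yosida_resolvent {l α : ℝ} (hl : 0 < l) (hα : 0 < α) (f : E) :
    yosida G l (G α f) = l • G l (α • G α f - f) := by
  rw [yosida_apply]
  congr 1
  have := hG.identity l hl α hα f
  rw [map_sub, map_smul, ← sub_eq_zero]
  have h2 : l • G l (G α f) - G α f - (α • G l (G α f) - G l f)
      = (G l f - G α f) - (α - l) • G l (G α f) := by
    rw [sub_smul]; abel
  rw [h2, this, sub_self]

lemma tendsto_yosida_resolvent {α : ℝ} (hα : 0 < α) (f : E) :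
    Tendsto (fun l => yosida G l (G α f)) atTop (𝓝 (α • G α f - f)) := by
  refine (hG.tendsto (α • G α f - f)).congr' ?_
  filter_upwards [eventually_gt_atTop 0] with l hl
  exact (hG.yosida_resolvent hl hα f).symm

end IsContractionResolvent

variable [CompleteSpace E]

/-- The exponential `e^{s (K - 1)}` is an infinite convex combination of the powers of `K`, so it
leaves invariant every closed convex set which `K` leaves invariant. -/
lemma exp_smul_sub_one_mem {M : Set E} (hM : Convex ℝ M) (hc : IsClosed M) {K : E →L[ℝ] E}
    (hK : ∀ f ∈ M, K f ∈ M) {s : ℝ} (hs : 0 ≤ s) {f : E} (hf : f ∈ M) :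
    NormedSpace.exp (s • (K - 1)) f ∈ M := by
  have hcomm : Commute (s • K) (algebraMap ℝ (E →L[ℝ] E) (-s)) :=
    (Algebra.commutes (-s) (s • K)).symm
  have h1 : s • (K - 1) = s • K + algebraMap ℝ (E →L[ℝ] E) (-s) := by
    rw [Algebra.algebraMap_eq_smul_one, smul_sub, neg_smul, sub_eq_add_neg]
  let _ : NormedAlgebra ℚ (E →L[ℝ] E) := NormedAlgebra.restrictScalars ℚ ℝ _
  have h2 : NormedSpace.exp (s • (K - 1)) = Real.exp (-s) • NormedSpace.exp (s • K) := by
    rw [h1, NormedSpace.exp_add_of_commute hcomm, ← NormedSpace.algebraMap_exp_comm,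
      ← Real.exp_eq_exp_ℝ, Algebra.smul_def (Real.exp (-s))]
    exact (Algebra.commutes _ _).symm
  have h3 : HasSum (fun n : ℕ => ((n.factorial : ℝ)⁻¹ • (s • K) ^ n) f)
      (NormedSpace.exp (s • K) f) :=
    (NormedSpace.exp_series_hasSum_exp' (𝕂 := ℝ) (s • K)).mapL (ContinuousLinearMap.apply ℝ E f)
  have h4 : HasSum (fun n : ℕ => (n.factorial : ℝ)⁻¹ • s ^ n) (Real.exp s) := by
    rw [Real.exp_eq_exp_ℝ]
    exact NormedSpace.exp_series_hasSum_exp' (𝕂 := ℝ) s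
  refine hM.hasSum_smul_mem hc (w := fun n => Real.exp (-s) * ((n.factorial : ℝ)⁻¹ • s ^ n))
    (z := fun n => (K ^ n) f) (fun k => by positivity) ?_ ?_ ?_
  · have := h4.mul_left (Real.exp (-s))
    rwa [← Real.exp_add, neg_add_cancel, Real.exp_zero] at this
  · intro k
    induction k with
    | zero => simpa using hf
    | succ k ih => rw [pow_succ']; exact hK _ ih
  · rw [h2]
    change HasSum _ (Real.exp (-s) • NormedSpace.exp (s • K) f)
    convert! h3.const_smul (Real.exp (-s)) using 2 with n
    simp only [smul_pow, smul_apply, smul_smul, smul_eq_mul]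

lemma exp_yosida_mem {G : ℝ → E →L[ℝ] E} {M : Set E} (hM : Convex ℝ M) (hc : IsClosed M) {l t : ℝ}
    (hl : 0 < l) (hK : ∀ f ∈ M, l • G l f ∈ M) (ht : 0 ≤ t) {f : E} (hf : f ∈ M) :
    NormedSpace.exp (t • yosida G l) f ∈ M := by
  rw [yosida, smul_smul]
  exact exp_smul_sub_one_mem hM hc (K := l • G l) hK (by positivity) hf

lemma IsContractionResolvent.norm_exp_yosida_le {G : ℝ → E →L[ℝ] E}
    (hG : IsContractionResolvent G) {l t : ℝ} (hl : 0 < l) (ht : 0 ≤ t) (f : E) :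
    ‖NormedSpace.exp (t • yosida G l) f‖ ≤ ‖f‖ := by
  have := exp_yosida_mem (G := G) (M := Metric.closedBall 0 ‖f‖) (convex_closedBall _ _)
    Metric.isClosed_closedBall hl (fun g hg => by
      rw [mem_closedBall_zero_iff] at hg ⊢
      exact (hG.norm_le l hl g).trans hg) ht (f := f) (by simp)
  simpa using this

lemma hasDerivAt_exp_smul_apply (B : E →L[ℝ] E) (f : E) (t : ℝ) :
    HasDerivAt (fun s : ℝ => NormedSpace.exp (s • B) f) (NormedSpace.exp (t • B) (B f)) t := by
  let _ : NormedAlgebra ℚ (E →L[ℝ] E) := NormedAlgebra.restrictScalars ℚ ℝ _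
  exact (hasDerivAt_exp_smul_const B t).clm_apply (hasDerivAt_const t f) |>.congr_deriv (by simp)

/-- Duhamel comparison: a curve whose velocity differs from `B U` by at most `ε` stays within `ε t`
of the flow of `B`, when this flow is contractive. -/
lemma norm_sub_exp_smul_le {B : E →L[ℝ] E}
    (hB : ∀ t : ℝ, 0 ≤ t → ∀ f, ‖NormedSpace.exp (t • B) f‖ ≤ ‖f‖) {U Z : ℝ → E} {t ε : ℝ}
    (ht : 0 ≤ t)
    (hU : ∀ s ∈ Icc 0 t, HasDerivWithinAt U (Z s) (Icc 0 t) s)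
    (hZ : ∀ s ∈ Icc 0 t, ‖Z s - B (U s)‖ ≤ ε) :
    ‖U t - NormedSpace.exp (t • B) (U 0)‖ ≤ ε * t := by
  let _ : NormedAlgebra ℚ (E →L[ℝ] E) := NormedAlgebra.restrictScalars ℚ ℝ _
  have key := norm_image_sub_le_of_norm_deriv_le_segment' (a := 0) (b := t) (C := ε)
    (f := fun s => NormedSpace.exp ((t - s) • B) (U s))
    (f' := fun s => NormedSpace.exp ((t - s) • B) (Z s - B (U s))) ?_ ?_ t ⟨ht, le_rfl⟩
  · simpa [NormedSpace.exp_zero] using key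
  · intro s hs
    have h1 : HasDerivAt (fun s : ℝ => NormedSpace.exp ((t - s) • B))
        (-(NormedSpace.exp ((t - s) • B) * B)) s := by
      have := (hasDerivAt_exp_smul_const B (t - s)).scomp s ((hasDerivAt_id s).const_sub t)
      simpa using! this
    refine (h1.hasDerivWithinAt.clm_apply (hU s hs)).congr_deriv ?_
    simp [map_sub]
    abel
  · intro s hs
    exact (hB (t - s) (by linarith [hs.2]) _).trans (hZ s ⟨hs.1, hs.2.le⟩)

end Semigroups

/-! ### The generator of a contraction semigroup -/

section Semigroups

variable {E : Type*} [NormedAddCommGroup E] [NormedSpace ℝ E]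

namespace IsContractionSemigroup

variable {T : ℝ → E →L[ℝ] E} (hT : IsContractionSemigroup T)
include hT

lemma norm_apply_le {t : ℝ} (ht : 0 ≤ t) (f : E) : ‖T t f‖ ≤ ‖f‖ :=
  (T t).le_of_opNorm_le_of_le (hT.contraction t ht) le_rfl |>.trans (by simp)

lemma add_apply {s t : ℝ} (hs : 0 ≤ s) (ht : 0 ≤ t) (f : E) : T (s + t) f = T s (T t f) := by
  rw [hT.add s hs t ht]; rfl

lemma continuous_max (f : E) : Continuous fun t : ℝ => T (max t 0) f := by
  have h0 : Tendsto (fun t : ℝ => T (max t 0) f) (𝓝 0) (𝓝 f) := by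
    rw [← nhdsLE_sup_nhdsGT (0 : ℝ)]
    refine Tendsto.sup ?_ ?_
    · refine tendsto_const_nhds.congr' ?_
      filter_upwards [self_mem_nhdsWithin] with t ht
      rw [max_eq_right ht, hT.zero]; rfl
    · refine (hT.continuous f).congr' ?_
      filter_upwards [self_mem_nhdsWithin] with t ht
      rw [max_eq_left (le_of_lt ht)]
  have hle : ∀ s t : ℝ, 0 ≤ s → s ≤ t → ‖T t f - T s f‖ ≤ ‖T (max (t - s) 0) f - f‖ := by
    intro s t hs hst
    have : T t f - T s f = T s (T (max (t - s) 0) f - f) := by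
      rw [max_eq_left (sub_nonneg.2 hst), map_sub, ← hT.add_apply hs (sub_nonneg.2 hst),
        add_sub_cancel]
    rw [this]
    exact hT.norm_apply_le hs _
  have habs : ∀ s t : ℝ, ‖T (max t 0) f - T (max s 0) f‖
      ≤ ‖T (max |max t 0 - max s 0| 0) f - f‖ := by
    intro s t
    rcases le_total (max s 0) (max t 0) with h | h
    · rw [abs_of_nonneg (sub_nonneg.2 h)]
      exact hle _ _ (le_max_right _ _) h
    · rw [abs_sub_comm, abs_of_nonneg (sub_nonneg.2 h), norm_sub_rev]
      exact hle _ _ (le_max_right _ _) h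
  refine continuous_iff_continuousAt.2 fun s => ?_
  rw [ContinuousAt, tendsto_iff_norm_sub_tendsto_zero]
  refine squeeze_zero (fun _ => norm_nonneg _) (habs s) ?_
  have h1 : Tendsto (fun t : ℝ => |max t 0 - max s 0|) (𝓝 s) (𝓝 0) := by
    have : Continuous fun t : ℝ => |max t 0 - max s 0| := by fun_prop
    simpa using! this.tendsto s
  simpa using ((h0.comp h1).sub_const f).norm

lemma continuous_exp_smul (α : ℝ) (f : E) :
    Continuous fun t : ℝ => Real.exp (-α * t) • T (max t 0) f :=
  (by fun_prop : Continuous fun t : ℝ => Real.exp (-α * t)).smul (hT.continuous_max f)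

lemma integrableOn_exp_smul {α : ℝ} (hα : 0 < α) (f : E) :
    IntegrableOn (fun t => Real.exp (-α * t) • T t f) (Ioi 0) := by
  have h1 : IntegrableOn (fun t => Real.exp (-α * t) • T (max t 0) f) (Ioi 0) := by
    refine Integrable.mono' ((exp_neg_integrableOn_Ioi 0 hα).mul_const ‖f‖) ?_ ?_
    · exact (hT.continuous_exp_smul α f).aestronglyMeasurable
    · filter_upwards with t
      rw [norm_smul, Real.norm_of_nonneg (Real.exp_pos _).le]
      gcongr
      exact hT.norm_apply_le (le_max_right _ _) f
  refine h1.congr_fun (fun t ht => ?_) measurableSet_Ioi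
  simp only [max_eq_left (le_of_lt (mem_Ioi.1 ht))]

variable [CompleteSpace E] {G : ℝ → E →L[ℝ] E} (hL : IsLaplaceTransform T G)
include hL

lemma comm_resolvent {α t : ℝ} (hα : 0 < α) (ht : 0 ≤ t) (f : E) :
    T t (G α f) = G α (T t f) := by
  rw [← hL α hα, ← hL α hα, ← ContinuousLinearMap.integral_comp_comm _
    (hT.integrableOn_exp_smul hα f)]
  refine setIntegral_congr_fun measurableSet_Ioi fun s hs => ?_
  have hs : (0 : ℝ) ≤ s := le_of_lt hs
  simp only [map_smul]
  rw [← hT.add_apply ht hs, ← hT.add_apply hs ht, add_comm]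

/-- `T_t G_α f` is the tail of the Laplace integral defining `G_α f`, shifted by `t`. -/
lemma apply_resolvent {α t : ℝ} (hα : 0 < α) (ht : 0 ≤ t) (f : E) :
    T t (G α f) = Real.exp (α * t) •
      (G α f - ∫ s in (0 : ℝ)..t, Real.exp (-α * s) • T (max s 0) f) := by
  have hi := hT.integrableOn_exp_smul hα f
  have h1 : ∫ s in (0 : ℝ)..t, Real.exp (-α * s) • T (max s 0) f =
      ∫ s in (0 : ℝ)..t, Real.exp (-α * s) • T s f := by
    refine intervalIntegral.integral_congr fun s hs => ?_
    rw [uIcc_of_le ht] at hs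
    simp only [max_eq_left hs.1]
  rw [h1, ← intervalIntegral.integral_Ioi_sub_Ioi hi ht, hL α hα f, sub_sub_cancel,
    ← integral_smul]
  have h2 := (measurePreserving_add_right (volume : Measure ℝ) t).setIntegral_preimage_emb
    (measurableEmbedding_addRight t)
    (fun s => Real.exp (α * t) • Real.exp (-α * s) • T s f) (Ioi t)
  rw [← h2, ← hL α hα f, ← ContinuousLinearMap.integral_comp_comm _ hi]
  have h3 : (fun x : ℝ => x + t) ⁻¹' Ioi t = Ioi 0 := by ext; simp
  rw [h3]
  refine setIntegral_congr_fun measurableSet_Ioi fun s hs => ?_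
  have hs : (0 : ℝ) ≤ s := le_of_lt hs
  simp only [map_smul]
  rw [smul_smul, ← Real.exp_add, ← hT.add_apply ht hs, add_comm s t]
  congr 2
  ring

/-- On the range of the resolvent the semigroup is differentiable, and its generator is
`α - G_α⁻¹`. -/
lemma hasDerivWithinAt_apply_resolvent {α s : ℝ} (hα : 0 < α) (hs : 0 ≤ s) (f : E) (r : Set ℝ)
    (hr : r ⊆ Ici 0) :
    HasDerivWithinAt (fun t => T t (G α f)) (T s (α • G α f - f)) r s := by
  have hc := hT.continuous_exp_smul α f
  have h1 : HasDerivAt (fun t => Real.exp (α * t) •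
      (G α f - ∫ s in (0 : ℝ)..t, Real.exp (-α * s) • T (max s 0) f))
      (T s (α • G α f - f)) s := by
    have h2 := (hc.integral_hasStrictDerivAt 0 s).hasDerivAt.const_sub (G α f)
    have h3 : HasDerivAt (fun t => Real.exp (α * t)) (Real.exp (α * s) * α) s := by
      simpa using ((hasDerivAt_id s).const_mul α).exp
    refine (h3.smul h2).congr_deriv ?_
    rw [map_sub, map_smul, hT.apply_resolvent hL hα hs f, max_eq_left hs, smul_neg, smul_smul,
      ← Real.exp_add]
    simp only [neg_mul, add_neg_cancel, Real.exp_zero, one_smul, smul_smul, mul_comm α (Real.exp _)]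
    abel
  exact h1.hasDerivWithinAt.congr (fun t ht => hT.apply_resolvent hL hα (hr ht) f)
    (hT.apply_resolvent hL hα hs f)

/-- A semigroup is determined by its resolvent: it is the strong limit of the exponentials of the
Yosida approximations. -/
lemma tendsto_exp_yosida (hG : IsContractionResolvent G) {t : ℝ} (ht : 0 ≤ t) (f : E) :
    Tendsto (fun l => NormedSpace.exp (t • yosida G l) f) atTop (𝓝 (T t f)) := by
  refine tendsto_apply_of_dense (hG.dense_range one_pos) ?_ (hT.norm_apply_le ht) ?_ f
  · filter_upwards [eventually_gt_atTop 0] with l hl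
    exact hG.norm_exp_yosida_le hl ht
  rintro _ ⟨g, rfl⟩
  have h1 : ∀ l > 0, ‖T t (G 1 g) - NormedSpace.exp (t • yosida G l) (G 1 g)‖ ≤
      ‖(1 : ℝ) • G 1 g - g - yosida G l (G 1 g)‖ * t := by
    intro l hl
    have := norm_sub_exp_smul_le (B := yosida G l)
      (fun t ht => hG.norm_exp_yosida_le hl ht) (U := fun s => T s (G 1 g))
      (Z := fun s => T s ((1 : ℝ) • G 1 g - g)) ht
      (fun s hs => hT.hasDerivWithinAt_apply_resolvent hL one_pos hs.1 g _ Icc_subset_Ici_self)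
      (ε := ‖(1 : ℝ) • G 1 g - g - yosida G l (G 1 g)‖) ?_
    · simpa [hT.zero] using this
    · intro s hs
      have : yosida G l (T s (G 1 g)) = T s (yosida G l (G 1 g)) := by
        simp only [yosida_apply, map_smul, map_sub, hT.comm_resolvent hL hl hs.1 (G 1 g)]
      rw [this, ← map_sub]
      exact hT.norm_apply_le hs.1 _
  rw [tendsto_iff_norm_sub_tendsto_zero]
  have h2 : Tendsto (fun l => ‖(1 : ℝ) • G 1 g - g - yosida G l (G 1 g)‖ * t) atTop (𝓝 0) := by
    have := ((hG.tendsto_yosida_resolvent one_pos g).const_sub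
      ((1 : ℝ) • G 1 g - g)).norm.mul_const t
    simpa using this
  refine squeeze_zero' (Eventually.of_forall fun _ => norm_nonneg _) ?_ h2
  filter_upwards [eventually_gt_atTop 0] with l hl
  rw [norm_sub_rev]
  exact h1 l hl

end IsContractionSemigroup

end Semigroups

/-! ### The Hille–Yosida theorem -/

section Semigroups

variable {E : Type*} [NormedAddCommGroup E] [NormedSpace ℝ E]

namespace IsContractionResolvent

variable [CompleteSpace E] {G : ℝ → E →L[ℝ] E} (hG : IsContractionResolvent G)
include hG

lemma norm_exp_yosida_sub_le {l m t : ℝ} (hl : 0 < l) (hm : 0 < m) (ht : 0 ≤ t) (f : E) :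
    ‖NormedSpace.exp (t • yosida G m) f - NormedSpace.exp (t • yosida G l) f‖ ≤
      ‖yosida G m f - yosida G l f‖ * t := by
  have hcomm : Commute (yosida G l) (yosida G m) := by
    refine ContinuousLinearMap.ext fun u => ?_
    change yosida G l (yosida G m u) = yosida G m (yosida G l u)
    simp only [yosida_apply, map_sub, map_smul, hG.comm hl hm u, smul_sub]
    module
  have key := norm_sub_exp_smul_le (B := yosida G l) (fun t ht => hG.norm_exp_yosida_le hl ht)
    (U := fun s => NormedSpace.exp (s • yosida G m) f)
    (Z := fun s => NormedSpace.exp (s • yosida G m) (yosida G m f)) ht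
    (fun s _ => (hasDerivAt_exp_smul_apply (yosida G m) f s).hasDerivWithinAt)
    (ε := ‖yosida G m f - yosida G l f‖) ?_
  · let _ : NormedAlgebra ℚ (E →L[ℝ] E) := NormedAlgebra.restrictScalars ℚ ℝ _
    simpa [NormedSpace.exp_zero] using key
  · intro s hs
    have h1 : Commute (yosida G l) (NormedSpace.exp (s • yosida G m)) :=
      (hcomm.smul_right s).exp_right
    have h2 : yosida G l (NormedSpace.exp (s • yosida G m) f) =
        NormedSpace.exp (s • yosida G m) (yosida G l f) := congrArg (fun A : E →L[ℝ] E => A f) h1.eq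
    rw [h2, ← map_sub]
    exact hG.norm_exp_yosida_le hm hs.1 _

lemma exists_tendsto_exp_yosida {t : ℝ} (ht : 0 ≤ t) (f : E) :
    ∃ z, Tendsto (fun l => NormedSpace.exp (t • yosida G l) f) atTop (𝓝 z) := by
  refine cauchySeq_tendsto_of_complete (Metric.cauchySeq_iff.2 fun ε hε => ?_)
  obtain ⟨_, ⟨g, rfl⟩, hu⟩ := Metric.mem_closure_iff.1 (hG.dense_range one_pos f) (ε / 3)
    (by positivity)
  obtain ⟨N, hN⟩ := Metric.cauchySeq_iff.1 (hG.tendsto_yosida_resolvent one_pos g).cauchySeq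
    (ε / 3 / (t + 1)) (by positivity)
  refine ⟨max N 1, fun m hm n hn => ?_⟩
  have hm0 : 0 < m := lt_of_lt_of_le (by positivity) ((le_max_right N 1).trans hm)
  have hn0 : 0 < n := lt_of_lt_of_le (by positivity) ((le_max_right N 1).trans hn)
  have h1 := hN m ((le_max_left _ _).trans hm) n ((le_max_left _ _).trans hn)
  have h2 := hG.norm_exp_yosida_sub_le hn0 hm0 ht (G 1 g)
  rw [dist_eq_norm] at h1 hu ⊢
  have h3 : ‖yosida G m (G 1 g) - yosida G n (G 1 g)‖ * t < ε / 3 := by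
    have h4 : ‖yosida G m (G 1 g) - yosida G n (G 1 g)‖ * (t + 1) < ε / 3 :=
      (lt_div_iff₀ (by positivity)).1 h1
    nlinarith [norm_nonneg (yosida G m (G 1 g) - yosida G n (G 1 g))]
  have h5 : NormedSpace.exp (t • yosida G m) f - NormedSpace.exp (t • yosida G n) f =
      NormedSpace.exp (t • yosida G m) (f - G 1 g) +
      (NormedSpace.exp (t • yosida G m) (G 1 g) - NormedSpace.exp (t • yosida G n) (G 1 g)) -
      NormedSpace.exp (t • yosida G n) (f - G 1 g) := by
    simp only [map_sub]; abel
  rw [h5]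
  have h6 := norm_sub_le (NormedSpace.exp (t • yosida G m) (f - G 1 g) +
      (NormedSpace.exp (t • yosida G m) (G 1 g) - NormedSpace.exp (t • yosida G n) (G 1 g)))
      (NormedSpace.exp (t • yosida G n) (f - G 1 g))
  have h7 := norm_add_le (NormedSpace.exp (t • yosida G m) (f - G 1 g))
      (NormedSpace.exp (t • yosida G m) (G 1 g) - NormedSpace.exp (t • yosida G n) (G 1 g))
  linarith [hG.norm_exp_yosida_le hm0 ht (f - G 1 g), hG.norm_exp_yosida_le hn0 ht (f - G 1 g)]

/-- The strong limit of the exponentials of the Yosida approximations. -/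
lemma exists_limit_exp_yosida : ∃ T : ℝ → E →L[ℝ] E, ∀ t ≥ 0, ∀ f,
    Tendsto (fun l => NormedSpace.exp (t • yosida G l) f) atTop (𝓝 (T t f)) := by
  have h : ∀ t : ℝ, ∃ S : E →L[ℝ] E, 0 ≤ t → ∀ f,
      Tendsto (fun l => NormedSpace.exp (t • yosida G l) f) atTop (𝓝 (S f)) := by
    intro t
    by_cases ht : 0 ≤ t
    · choose Z hZ using fun f => hG.exists_tendsto_exp_yosida ht f
      have hbound : ∀ f, ‖Z f‖ ≤ 1 * ‖f‖ := fun f => by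
        rw [one_mul]
        refine le_of_tendsto (hZ f).norm ?_
        filter_upwards [eventually_gt_atTop 0] with l hl
        exact hG.norm_exp_yosida_le hl ht f
      refine ⟨LinearMap.mkContinuous ⟨⟨Z, fun f g => ?_⟩, fun c f => ?_⟩ 1 hbound, fun _ f => hZ f⟩
      · refine tendsto_nhds_unique (hZ (f + g)) ?_
        simpa only [map_add] using (hZ f).add (hZ g)
      · refine tendsto_nhds_unique (hZ (c • f)) ?_
        simpa only [map_smul, RingHom.id_apply] using (hZ f).const_smul c
    · exact ⟨0, fun h => absurd h ht⟩
  choose T hT using h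
  exact ⟨T, hT⟩

lemma isContractionSemigroup_of_tendsto {T : ℝ → E →L[ℝ] E} (hT : ∀ t ≥ 0, ∀ f,
    Tendsto (fun l => NormedSpace.exp (t • yosida G l) f) atTop (𝓝 (T t f))) :
    IsContractionSemigroup T := by
  let _ : NormedAlgebra ℚ (E →L[ℝ] E) := NormedAlgebra.restrictScalars ℚ ℝ _
  have hbound : ∀ t ≥ 0, ∀ f, ‖T t f‖ ≤ ‖f‖ := fun t ht f => by
    refine le_of_tendsto (hT t ht f).norm ?_
    filter_upwards [eventually_gt_atTop 0] with l hl
    exact hG.norm_exp_yosida_le hl ht f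
  refine ⟨?_, ?_, ?_, ?_⟩
  · refine ContinuousLinearMap.ext fun f => tendsto_nhds_unique (hT 0 le_rfl f) ?_
    simp [NormedSpace.exp_zero]
  · intro s hs t ht
    refine ContinuousLinearMap.ext fun f => ?_
    refine tendsto_nhds_unique (hT (s + t) (add_nonneg hs ht) f) ?_
    have h1 : ∀ l, NormedSpace.exp ((s + t) • yosida G l) f = NormedSpace.exp (s • yosida G l)
        (NormedSpace.exp (t • yosida G l) f) := fun l => by
      rw [add_smul, NormedSpace.exp_add_of_commute (((Commute.refl _).smul_left s).smul_right t)]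
      rfl
    simp only [h1, ContinuousLinearMap.comp_apply]
    rw [tendsto_iff_norm_sub_tendsto_zero]
    have h2 := (tendsto_iff_norm_sub_tendsto_zero.1 (hT t ht f)).add
      (tendsto_iff_norm_sub_tendsto_zero.1 (hT s hs (T t f)))
    rw [add_zero] at h2
    refine squeeze_zero' (Eventually.of_forall fun _ => norm_nonneg _) ?_ h2
    filter_upwards [eventually_gt_atTop 0] with l hl
    refine (norm_sub_le_norm_sub_add_norm_sub _ (NormedSpace.exp (s • yosida G l) (T t f))
      _).trans ?_
    gcongr
    rw [← map_sub]
    exact hG.norm_exp_yosida_le hl hs _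
  · intro t ht
    exact ContinuousLinearMap.opNorm_le_bound _ zero_le_one (by simpa using hbound t ht)
  · intro f
    refine tendsto_apply_of_dense (S₀ := ContinuousLinearMap.id ℝ E) (hG.dense_range one_pos)
      ?_ (fun _ => le_rfl) ?_ f
    · filter_upwards [self_mem_nhdsWithin] with t ht
      exact hbound t (le_of_lt ht)
    · rintro _ ⟨g, rfl⟩
      rw [tendsto_iff_norm_sub_tendsto_zero]
      have h1 : ∀ t ≥ 0, ‖T t (G 1 g) - G 1 g‖ ≤ ‖(1 : ℝ) • G 1 g - g‖ * t := by
        intro t ht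
        refine le_of_tendsto_of_tendsto ((hT t ht (G 1 g)).sub_const (G 1 g)).norm
          ((hG.tendsto_yosida_resolvent one_pos g).norm.mul_const t) ?_
        filter_upwards [eventually_gt_atTop 0] with l hl
        have := norm_image_sub_le_of_norm_deriv_le_segment' (a := 0) (b := t)
          (f := fun s => NormedSpace.exp (s • yosida G l) (G 1 g)) (C := ‖yosida G l (G 1 g)‖)
          (fun s _ => (hasDerivAt_exp_smul_apply (yosida G l) (G 1 g) s).hasDerivWithinAt)
          (fun s hs => hG.norm_exp_yosida_le hl hs.1 _) t ⟨ht, le_rfl⟩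
        simpa [NormedSpace.exp_zero] using this
      have h2 : Tendsto (fun t : ℝ => ‖(1 : ℝ) • G 1 g - g‖ * t) (𝓝[>] 0) (𝓝 0) := by
        have : Continuous fun t : ℝ => ‖(1 : ℝ) • G 1 g - g‖ * t := by fun_prop
        simpa using (this.tendsto 0).mono_left nhdsWithin_le_nhds
      refine squeeze_zero' (Eventually.of_forall fun _ => norm_nonneg _) ?_ h2
      filter_upwards [self_mem_nhdsWithin] with t ht
      exact h1 t (le_of_lt ht)

/-- The Laplace transform of `e^{tA}`, with `A` a Yosida approximation, inverts `α - A`. -/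
lemma integral_exp_yosida {l α : ℝ} (hl : 0 < l) (hα : 0 < α) (u : E) :
    ∫ t in Ioi (0 : ℝ), Real.exp (-α * t) • NormedSpace.exp (t • yosida G l) (α • u - yosida G l u)
      = u := by
  let _ : NormedAlgebra ℚ (E →L[ℝ] E) := NormedAlgebra.restrictScalars ℚ ℝ _
  have hc : ∀ v, Continuous fun t : ℝ =>
      Real.exp (-α * t) • NormedSpace.exp (t • yosida G l) v := by
    intro v
    have : Continuous fun t : ℝ => NormedSpace.exp (t • yosida G l) v :=
      continuous_iff_continuousAt.2 fun t =>
        (hasDerivAt_exp_smul_apply (yosida G l) v t).continuousAt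
    exact (by fun_prop : Continuous fun t : ℝ => Real.exp (-α * t)).smul this
  have hb : ∀ v, ∀ t ≥ 0, ‖Real.exp (-α * t) • NormedSpace.exp (t • yosida G l) v‖ ≤
      Real.exp (-α * t) * ‖v‖ := by
    intro v t ht
    rw [norm_smul, Real.norm_of_nonneg (Real.exp_pos _).le]
    gcongr
    exact hG.norm_exp_yosida_le hl ht v
  have key := integral_Ioi_of_hasDerivAt_of_tendsto (a := 0) (m := 0)
    (f := fun t => -(Real.exp (-α * t) • NormedSpace.exp (t • yosida G l) u))
    (f' := fun t => Real.exp (-α * t) • NormedSpace.exp (t • yosida G l) (α • u - yosida G l u))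
    (hc u).neg.continuousWithinAt ?_ ?_ ?_
  · simpa [NormedSpace.exp_zero] using key
  · intro t _
    have h1 : HasDerivAt (fun t => Real.exp (-α * t)) (Real.exp (-α * t) * -α) t := by
      simpa using ((hasDerivAt_id t).const_mul (-α)).exp
    refine (h1.smul (hasDerivAt_exp_smul_apply (yosida G l) u t)).neg.congr_deriv ?_
    simp only [map_sub, map_smul]
    module
  · refine Integrable.mono' ((exp_neg_integrableOn_Ioi 0 hα).mul_const ‖α • u - yosida G l u‖)
      (hc _).aestronglyMeasurable ?_
    filter_upwards [ae_restrict_mem measurableSet_Ioi] with t ht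
    exact hb _ t (le_of_lt ht)
  · have h1 : Tendsto (fun t : ℝ => Real.exp (-α * t) * ‖u‖) atTop (𝓝 0) := by
      have h2 : Tendsto (fun t : ℝ => -α * t) atTop atBot :=
        tendsto_id.const_mul_atTop_of_neg (by linarith)
      simpa using (Real.tendsto_exp_atBot.comp h2).mul_const ‖u‖
    refine squeeze_zero_norm' ?_ h1
    filter_upwards [eventually_ge_atTop 0] with t ht
    rw [norm_neg]
    exact hb u t ht

/-- **Hille–Yosida theorem** for contraction resolvents. -/
theorem exists_semigroup : ∃ T, IsContractionSemigroup T ∧ IsLaplaceTransform T G := by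
  obtain ⟨T, hT⟩ := hG.exists_limit_exp_yosida
  refine ⟨T, hG.isContractionSemigroup_of_tendsto hT, fun α hα f => ?_⟩
  let v : ℝ → E := fun l => α • G α f - yosida G l (G α f)
  have hv : Tendsto v atTop (𝓝 f) := by
    have := (hG.tendsto_yosida_resolvent hα f).const_sub (α • G α f)
    simpa using this
  have hlim : Tendsto (fun l => ∫ t in Ioi (0 : ℝ),
      Real.exp (-α * t) • NormedSpace.exp (t • yosida G l) (v l)) atTop
      (𝓝 (∫ t in Ioi (0 : ℝ), Real.exp (-α * t) • T t f)) := by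
    refine tendsto_integral_filter_of_dominated_convergence
      (fun t => Real.exp (-α * t) * (‖f‖ + 1)) ?_ ?_
      ((exp_neg_integrableOn_Ioi 0 hα).mul_const _) ?_
    · refine Eventually.of_forall fun l => Continuous.aestronglyMeasurable ?_
      have : Continuous fun t : ℝ => NormedSpace.exp (t • yosida G l) (v l) :=
        continuous_iff_continuousAt.2 fun t =>
          (hasDerivAt_exp_smul_apply (yosida G l) (v l) t).continuousAt
      exact (by fun_prop : Continuous fun t : ℝ => Real.exp (-α * t)).smul this
    · filter_upwards [eventually_gt_atTop 0,
        hv.norm.eventually_le_const (lt_add_one ‖f‖)] with l hl hvl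
      filter_upwards [ae_restrict_mem measurableSet_Ioi] with t ht
      rw [norm_smul, Real.norm_of_nonneg (Real.exp_pos _).le]
      gcongr
      exact (hG.norm_exp_yosida_le hl (le_of_lt ht) _).trans hvl
    · filter_upwards [ae_restrict_mem measurableSet_Ioi] with t ht
      refine Tendsto.const_smul ?_ _
      rw [tendsto_iff_norm_sub_tendsto_zero]
      have h2 := (tendsto_iff_norm_sub_tendsto_zero.1 hv).add
        (tendsto_iff_norm_sub_tendsto_zero.1 (hT t (le_of_lt ht) f))
      rw [add_zero] at h2
      refine squeeze_zero' (Eventually.of_forall fun _ => norm_nonneg _) ?_ h2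
      filter_upwards [eventually_gt_atTop 0] with l hl
      refine (norm_sub_le_norm_sub_add_norm_sub _ (NormedSpace.exp (t • yosida G l) f) _).trans ?_
      gcongr
      rw [← map_sub]
      exact hG.norm_exp_yosida_le hl (le_of_lt ht) _
  -- the integrals on the left are constant, equal to `G_α f`
  refine tendsto_nhds_unique hlim (tendsto_const_nhds.congr' ?_)
  filter_upwards [eventually_gt_atTop 0] with l hl
  exact (hG.integral_exp_yosida hl hα (G α f)).symm

end IsContractionResolvent

end Semigroups

/-! ### Closed forms as embedded Hilbert spaces -/

section EnergySpaces

variable {V F F' : Type*} [NormedAddCommGroup V] [InnerProductSpace ℝ V]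
  [NormedAddCommGroup F] [InnerProductSpace ℝ F] [NormedAddCommGroup F'] [InnerProductSpace ℝ F']

/-- The Hilbert space `V` of a closed form: `i : V → F` is the inclusion of the domain into the
ambient space and `d : V → F'` a gradient, so that the form is `⟪d p, d q⟫` and the inner product of
`V` is the form shifted by `1`. -/
structure IsEnergySpace (i : V →L[ℝ] F) (d : V →L[ℝ] F') : Prop where
  inner_eq : ∀ p q, inner ℝ p q = inner ℝ (i p) (i q) + inner ℝ (d p) (d q)
  denseRange : DenseRange i

/-- `R α` maps `f` to the solution `p` of `⟪d p, d q⟫ + α ⟪i p, i q⟫ = ⟪f, i q⟫` for all `q`. -/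
def IsResolventMap (i : V →L[ℝ] F) (d : V →L[ℝ] F') (R : ℝ → F →L[ℝ] V) : Prop :=
  ∀ α > 0, ∀ f q, inner ℝ (d (R α f)) (d q) + α * inner ℝ (i (R α f)) (i q) = inner ℝ f (i q)

lemma IsResolventMap.inner_comm {i : V →L[ℝ] F} {d : V →L[ℝ] F'} {R : ℝ → F →L[ℝ] V}
    (hR : IsResolventMap i d R) {α : ℝ} (hα : 0 < α) (f g : F) :
    inner ℝ (i (R α f)) g = inner ℝ f (i (R α g)) := by
  rw [← hR α hα f (R α g), real_inner_comm, ← hR α hα g (R α f),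
    real_inner_comm (d (R α f)), real_inner_comm (i (R α f))]

namespace IsEnergySpace

variable {i : V →L[ℝ] F} {d : V →L[ℝ] F'} (h : IsEnergySpace i d)
include h

lemma norm_sq (p : V) : ‖p‖ ^ 2 = ‖i p‖ ^ 2 + ‖d p‖ ^ 2 := by
  simp only [← real_inner_self_eq_norm_sq]
  exact h.inner_eq p p

/-- The resolvent exists because `d* d + α i* i` is coercive on `V`, hence invertible. -/
lemma exists_resolventMap [CompleteSpace V] [CompleteSpace F] [CompleteSpace F'] :
    ∃ R, IsResolventMap i d R := by
  have key : ∀ α : ℝ, ∃ S : F →L[ℝ] V, 0 < α → ∀ f q,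
      inner ℝ (d (S f)) (d q) + α * inner ℝ (i (S f)) (i q) = inner ℝ f (i q) := by
    intro α
    by_cases hα : 0 < α
    swap
    · exact ⟨0, fun h => absurd h hα⟩
    let A : V →L[ℝ] V := d.adjoint.comp d + α • i.adjoint.comp i
    have hA : ∀ p q, inner ℝ (A p) q = inner ℝ (d p) (d q) + α * inner ℝ (i p) (i q) := by
      intro p q
      simp [A, inner_add_left, inner_smul_left, ContinuousLinearMap.adjoint_inner_left]
    have hu : IsUnit A := by
      refine ContinuousLinearMap.isUnit_of_forall_le_norm_inner_map A
        (c := ⟨min 1 α, by positivity⟩) (by change 0 < min 1 α; positivity) fun p => ?_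
      rw [hA, real_inner_self_eq_norm_sq, real_inner_self_eq_norm_sq, h.norm_sq,
        Real.norm_of_nonneg (by positivity)]
      change _ * min 1 α ≤ _
      nlinarith [min_le_left 1 α, min_le_right 1 α, sq_nonneg ‖i p‖, sq_nonneg ‖d p‖]
    obtain ⟨U, hU⟩ := hu
    refine ⟨(U⁻¹.val).comp i.adjoint, fun _ f q => ?_⟩
    rw [← hA]
    have : A ((U⁻¹.val).comp i.adjoint f) = i.adjoint f := by
      rw [← hU]
      change (U.val * U⁻¹.val) (i.adjoint f) = _
      simp
    rw [this, ContinuousLinearMap.adjoint_inner_left]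
  choose R hR using key
  exact ⟨R, fun α hα => hR α hα⟩

/-- A bounded sequence of `V` whose image in `F` converges has a weak limit in `V`. -/
lemma exists_of_tendsto [CompleteSpace V] [CompleteSpace F] [CompleteSpace F'] {p : ℕ → V} {f : F}
    (hf : Tendsto (fun n => i (p n)) atTop (𝓝 f)) {c : ℕ → ℝ} {C : ℝ} (hpc : ∀ n, ‖d (p n)‖ ≤ c n)
    (hc : Tendsto c atTop (𝓝 C)) : ∃ q, i q = f ∧ ‖d q‖ ≤ C := by
  obtain ⟨M₁, hM₁⟩ := hf.norm.bddAbove_range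
  obtain ⟨M₂, hM₂⟩ := hc.bddAbove_range
  have hM1 : ∀ n, ‖i (p n)‖ ≤ M₁ := fun n => hM₁ ⟨n, rfl⟩
  have hM2 : ∀ n, ‖d (p n)‖ ≤ M₂ := fun n => (hpc n).trans (hM₂ ⟨n, rfl⟩)
  have hbound : ∀ n, ‖p n‖ ≤ M₁ + M₂ := by
    intro n
    have := h.norm_sq (p n)
    have h1 := hM1 n
    have h2 := hM2 n
    refine abs_le_of_sq_le_sq' ?_ (by linarith [norm_nonneg (i (p n)), norm_nonneg (d (p n))]) |>.2
    nlinarith [norm_nonneg (i (p n)), norm_nonneg (d (p n))]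
  let φ : ℕ → WeakDual ℝ V := fun n =>
    StrongDual.toWeakDual (InnerProductSpace.toDual ℝ V (p n))
  let U : Ultrafilter (WeakDual ℝ V) := (hyperfilter ℕ).map φ
  obtain ⟨ψ, -, hψ⟩ := (WeakDual.isCompact_closedBall (𝕜 := ℝ) (0 : StrongDual ℝ V)
    (M₁ + M₂)).ultrafilter_le_nhds U (by
      refine le_principal_iff.2 (Filter.mem_map.2 (univ_mem' fun n => ?_))
      change InnerProductSpace.toDual ℝ V (p n) ∈ Metric.closedBall 0 (M₁ + M₂)
      simpa using hbound n)
  let q : V := (InnerProductSpace.toDual ℝ V).symm (WeakDual.toStrongDual ψ)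
  have hq : ∀ v, Tendsto (fun n => inner ℝ (p n) v) (hyperfilter ℕ) (𝓝 (inner ℝ q v)) := by
    intro v
    have h1 : Tendsto φ (hyperfilter ℕ) (𝓝 ψ) := hψ
    have h2 := ((WeakDual.eval_continuous v).tendsto ψ).comp h1
    have h3 : inner ℝ q v = ψ v := InnerProductSpace.toDual_symm_apply
    rw [h3]
    exact h2
  have hle : (hyperfilter ℕ : Filter ℕ) ≤ atTop := Nat.hyperfilter_le_atTop
  refine ⟨q, ext_inner_right ℝ fun g => ?_, ?_⟩
  · have h1 := hq (i.adjoint g)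
    simp only [ContinuousLinearMap.adjoint_inner_right] at h1
    exact tendsto_nhds_unique h1 ((hf.mono_left hle).inner tendsto_const_nhds)
  · have h1 := hq (d.adjoint (d q))
    simp only [ContinuousLinearMap.adjoint_inner_right] at h1
    have h2 : inner ℝ (d q) (d q) ≤ C * ‖d q‖ := by
      refine le_of_tendsto_of_tendsto h1 ((hc.mono_left hle).mul_const ‖d q‖)
        (Eventually.of_forall fun n => ?_)
      exact (real_inner_le_norm _ _).trans (mul_le_mul_of_nonneg_right (hpc n) (norm_nonneg _))
    rw [real_inner_self_eq_norm_sq] at h2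
    have hC : 0 ≤ C := ge_of_tendsto' hc fun n => (norm_nonneg _).trans (hpc n)
    rcases (norm_nonneg (d q)).eq_or_lt with h0 | h0
    · rw [← h0]; exact hC
    · nlinarith

variable {R : ℝ → F →L[ℝ] V} (hR : IsResolventMap i d R)
include hR

lemma eq_resolvent {α : ℝ} (hα : 0 < α) {f : F} {p : V}
    (hp : ∀ q, inner ℝ (d p) (d q) + α * inner ℝ (i p) (i q) = inner ℝ f (i q)) : p = R α f := by
  have h1 := hp (p - R α f)
  rw [← hR α hα f] at h1
  have h2 : ‖d (p - R α f)‖ ^ 2 + α * ‖i (p - R α f)‖ ^ 2 = 0 := by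
    simp only [← real_inner_self_eq_norm_sq]
    rw [map_sub d p, map_sub i p, inner_sub_left (d p), inner_sub_left (i p)]
    rw [map_sub d p, map_sub i p] at h1
    linarith
  have h3 : ‖i (p - R α f)‖ ^ 2 = 0 := by
    have : 0 ≤ ‖d (p - R α f)‖ ^ 2 := by positivity
    have h4 : 0 ≤ ‖i (p - R α f)‖ ^ 2 := by positivity
    have h5 : 0 ≤ α * ‖i (p - R α f)‖ ^ 2 := by positivity
    have h6 : α * ‖i (p - R α f)‖ ^ 2 = 0 := by linarith
    exact (mul_eq_zero.1 h6).resolve_left hα.ne'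
  have h4 : ‖p - R α f‖ ^ 2 = 0 := by
    rw [h.norm_sq, h3, zero_add]
    rw [h3] at h2
    linarith
  exact sub_eq_zero.1 (norm_eq_zero.1 (pow_eq_zero_iff two_ne_zero |>.1 h4))

lemma isContractionResolvent : IsContractionResolvent fun α => i.comp (R α) := by
  have hnorm : ∀ α > 0, ∀ f, ‖α • i (R α f)‖ ≤ ‖f‖ := by
    intro α hα f
    have h1 := hR α hα f (R α f)
    rw [real_inner_self_eq_norm_sq, real_inner_self_eq_norm_sq] at h1
    have h2 := real_inner_le_norm f (i (R α f))
    have h3 : 0 ≤ ‖d (R α f)‖ ^ 2 := by positivity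
    rw [norm_smul, Real.norm_of_nonneg hα.le]
    rcases (norm_nonneg (i (R α f))).eq_or_lt with h0 | h0
    · rw [← h0, mul_zero]; exact norm_nonneg f
    · nlinarith
  refine ⟨fun α hα β hβ f => ?_, hnorm, fun f => ?_⟩
  · have h1 : R β f + (β - α) • R α (i (R β f)) = R α f := by
      refine h.eq_resolvent hR hα fun q => ?_
      have h2 := hR α hα (i (R β f)) q
      have h3 := hR β hβ f q
      simp only [map_add, map_smul, inner_add_left, inner_smul_left, conj_trivial]
      linear_combination h3 + (β - α) * h2
    change i (R α f) - i (R β f) = (β - α) • i (R α (i (R β f)))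
    rw [← h1, map_add, map_smul, add_sub_cancel_left]
  · refine tendsto_apply_of_dense (S := fun α => α • i.comp (R α))
      (S₀ := ContinuousLinearMap.id ℝ F) h.denseRange ?_ (fun _ => le_rfl) ?_ f
    · filter_upwards [eventually_gt_atTop 0] with α hα
      exact hnorm α hα
    · rintro _ ⟨p, rfl⟩
      change Tendsto (fun α => α • i (R α (i p))) atTop (𝓝 (i p))
      rw [tendsto_iff_norm_sub_tendsto_zero]
      have h1 : Tendsto (fun α : ℝ => √(‖d p‖ ^ 2 / α)) atTop (𝓝 0) := by
        have := (tendsto_const_nhds (x := ‖d p‖ ^ 2)).div_atTop (tendsto_id (α := ℝ) (x := atTop))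
        have h2 := (Real.continuous_sqrt.tendsto 0).comp this
        rwa [Real.sqrt_zero] at h2
      refine squeeze_zero' (Eventually.of_forall fun _ => norm_nonneg _) ?_ h1
      filter_upwards [eventually_gt_atTop 0] with α hα
      refine Real.le_sqrt_of_sq_le ?_
      rw [le_div_iff₀ hα]
      -- `q = α R_α i p - p` solves `E_α(q, ·) = -E(p, ·)`; test this with `q` itself
      set q := α • R α (i p) - p with hq
      have h2 : α • i (R α (i p)) - i p = i q := by rw [hq, map_sub, map_smul]
      have h3 := hR α hα (i p) q
      have h4 : ‖d q‖ ^ 2 + α * ‖i q‖ ^ 2 = -inner ℝ (d p) (d q) := by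
        simp only [← real_inner_self_eq_norm_sq]
        have e1 : d q = α • d (R α (i p)) - d p := by rw [hq, map_sub, map_smul]
        have e2 : inner ℝ (d q) (d q) =
            α * inner ℝ (d (R α (i p))) (d q) - inner ℝ (d p) (d q) := by
          conv_lhs => rw [e1, inner_sub_left, inner_smul_left, ← e1]
          rfl
        have e3 : inner ℝ (i q) (i q) =
            α * inner ℝ (i (R α (i p))) (i q) - inner ℝ (i p) (i q) := by
          conv_lhs => rw [← h2, inner_sub_left, inner_smul_left, h2]
          rfl
        rw [e2, e3]
        linear_combination α * h3
      have h5 : -inner ℝ (d p) (d q) ≤ ‖d p‖ * ‖d q‖ :=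
        (neg_le_abs _).trans (abs_real_inner_le_norm _ _)
      rw [h2]
      nlinarith [sq_nonneg (‖d p‖ - ‖d q‖), sq_nonneg ‖d p‖, sq_nonneg ‖d q‖]

end IsEnergySpace

end EnergySpaces

/-! ### Forms represented by an energy space -/

section Forms

variable {X : Type*} [MeasurableSpace X] {μ : Measure X}
  {V F' : Type*} [NormedAddCommGroup V] [InnerProductSpace ℝ V]
  [NormedAddCommGroup F'] [InnerProductSpace ℝ F']

/-- The form `(B, D)` is represented by the energy space `(i, d)`: its domain is the range of `i`
and its value at `(i p, i q)` is `⟪d p, d q⟫`. -/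
structure IsFormOf (i : V →L[ℝ] Lp ℝ 2 μ) (d : V →L[ℝ] F') (D : Set (Lp ℝ 2 μ))
    (B : Lp ℝ 2 μ → Lp ℝ 2 μ → ℝ) : Prop where
  energySpace : IsEnergySpace i d
  domain : D = range i
  form : ∀ p q, B (i p) (i q) = inner ℝ (d p) (d q)

lemma IsSemigroupOfForm.isContractionSemigroup {D : Set (Lp ℝ 2 μ)}
    {B : Lp ℝ 2 μ → Lp ℝ 2 μ → ℝ} {T : ℝ → Lp ℝ 2 μ →L[ℝ] Lp ℝ 2 μ}
    (hT : IsSemigroupOfForm D B T) : IsContractionSemigroup T :=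
  ⟨hT.zero, hT.add, hT.contraction, hT.continuous⟩

namespace IsFormOf

variable {i : V →L[ℝ] Lp ℝ 2 μ} {d : V →L[ℝ] F'} {D : Set (Lp ℝ 2 μ)}
  {B : Lp ℝ 2 μ → Lp ℝ 2 μ → ℝ} (h : IsFormOf i d D B)
include h

lemma mem (p : V) : i p ∈ D := h.domain ▸ mem_range_self p

lemma exists_eq {u : Lp ℝ 2 μ} (hu : u ∈ D) : ∃ p, i p = u := by
  rw [h.domain] at hu; exact hu

lemma formShift_eq (α : ℝ) (p q : V) :
    formShift B α (i p) (i q) = inner ℝ (d p) (d q) + α * inner ℝ (i p) (i q) := by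
  rw [formShift, h.form]

lemma formShift_one_self (p : V) : formShift B 1 (i p) (i p) = ‖p‖ ^ 2 := by
  rw [h.formShift_eq, ← real_inner_self_eq_norm_sq, h.energySpace.inner_eq]
  ring

lemma isSymmetricForm : IsSymmetricForm D B where
  zero_mem := by simpa using h.mem 0
  add_mem u hu v hv := by
    obtain ⟨p, rfl⟩ := h.exists_eq hu
    obtain ⟨q, rfl⟩ := h.exists_eq hv
    simpa using h.mem (p + q)
  smul_mem c u hu := by
    obtain ⟨p, rfl⟩ := h.exists_eq hu
    simpa using h.mem (c • p)
  dense := by rw [h.domain]; exact h.energySpace.denseRange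
  symm u hu v hv := by
    obtain ⟨p, rfl⟩ := h.exists_eq hu
    obtain ⟨q, rfl⟩ := h.exists_eq hv
    rw [h.form, h.form, real_inner_comm]
  add_left u hu v hv w hw := by
    obtain ⟨p, rfl⟩ := h.exists_eq hu
    obtain ⟨q, rfl⟩ := h.exists_eq hv
    obtain ⟨r, rfl⟩ := h.exists_eq hw
    rw [← map_add, h.form, h.form, h.form, map_add, inner_add_left]
  smul_left c u hu v hv := by
    obtain ⟨p, rfl⟩ := h.exists_eq hu
    obtain ⟨q, rfl⟩ := h.exists_eq hv
    rw [← map_smul, h.form, h.form, map_smul, real_inner_smul_left]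
  nonneg u hu := by
    obtain ⟨p, rfl⟩ := h.exists_eq hu
    rw [h.form]
    exact real_inner_self_nonneg

lemma isClosedForm [CompleteSpace V] : IsClosedForm D B := by
  intro u hu hc
  choose p hp using fun n => h.exists_eq (hu n)
  have hnorm : ∀ q r : V, formShift B 1 (i q - i r) (i q - i r) = ‖q - r‖ ^ 2 := fun q r => by
    rw [← map_sub, h.formShift_one_self]
  have hcau : CauchySeq p := by
    refine Metric.cauchySeq_iff.2 fun ε hε => ?_
    obtain ⟨N, hN⟩ := hc (ε ^ 2) (by positivity)
    refine ⟨N, fun m hm n hn => ?_⟩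
    have := hN m hm n hn
    rw [← hp, ← hp, hnorm] at this
    rw [dist_eq_norm]
    exact lt_of_pow_lt_pow_left₀ 2 hε.le this
  obtain ⟨q, hq⟩ := cauchySeq_tendsto_of_complete hcau
  refine ⟨i q, h.mem q, ?_⟩
  simp only [← hp, hnorm]
  have := (tendsto_iff_norm_sub_tendsto_zero.1 hq).pow 2
  simpa using this

lemma isLaplaceTransform {R : ℝ → Lp ℝ 2 μ →L[ℝ] V} (hR : IsResolventMap i d R)
    {T : ℝ → Lp ℝ 2 μ →L[ℝ] Lp ℝ 2 μ} (hT : IsSemigroupOfForm D B T) :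
    IsLaplaceTransform T fun α => i.comp (R α) := by
  intro α hα f
  obtain ⟨p, hp⟩ := h.exists_eq (hT.resolvent_mem α hα f)
  rw [← hp]
  refine congrArg i (h.energySpace.eq_resolvent hR hα fun q => ?_)
  rw [← h.formShift_eq, hp]
  exact hT.resolvent_eq α hα f _ (h.mem q)

/-- Every closed form has an associated semigroup. -/
lemma exists_isSemigroupOfForm [CompleteSpace V] [CompleteSpace F'] :
    ∃ T, IsSemigroupOfForm D B T := by
  obtain ⟨R, hR⟩ := h.energySpace.exists_resolventMap
  have hG := h.energySpace.isContractionResolvent hR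
  obtain ⟨T, hT, hL⟩ := hG.exists_semigroup
  refine ⟨T, hT.zero, hT.add, hT.contraction, fun t ht f g => ?_, hT.continuous, ?_, ?_⟩
  · have hsymm : ∀ l > 0, ∀ f g,
        inner ℝ (NormedSpace.exp (t • yosida (fun α => i.comp (R α)) l) f) g =
        inner ℝ f (NormedSpace.exp (t • yosida (fun α => i.comp (R α)) l) g) := by
      intro l hl f g
      have h1 : IsSelfAdjoint (i.comp (R l)) :=
        ContinuousLinearMap.isSelfAdjoint_iff_isSymmetric.2
          (hR.inner_comm hl)
      have h2 : IsSelfAdjoint (t • yosida (fun α => i.comp (R α)) l) :=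
        (IsSelfAdjoint.all t).smul ((IsSelfAdjoint.all l).smul
          (((IsSelfAdjoint.all l).smul h1).sub (IsSelfAdjoint.one _)))
      exact ContinuousLinearMap.isSelfAdjoint_iff_isSymmetric.1 h2.exp f g
    refine tendsto_nhds_unique ((hT.tendsto_exp_yosida hL hG ht f).inner tendsto_const_nhds) ?_
    refine (tendsto_const_nhds.inner (hT.tendsto_exp_yosida hL hG ht g)).congr' ?_
    filter_upwards [eventually_gt_atTop 0] with l hl
    exact (hsymm l hl f g).symm
  · intro α hα f
    rw [hL α hα f]
    exact h.mem (R α f)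
  · intro α hα f v hv
    obtain ⟨q, rfl⟩ := h.exists_eq hv
    rw [hL α hα f]
    exact (h.formShift_eq α (R α f) q).trans (hR α hα f q)

end IsFormOf

/-! ### Markov property and positivity -/

instance instIsOrderedModuleLpReal : IsOrderedModule ℝ (Lp ℝ 2 μ) where
  smul_le_smul_of_nonneg_left c hc f g hfg := by
    rw [← Lp.coeFn_le] at hfg ⊢
    filter_upwards [hfg, Lp.coeFn_smul c f, Lp.coeFn_smul c g] with x h1 h2 h3
    rw [h2, h3]
    exact mul_le_mul_of_nonneg_left h1 hc
  smul_le_smul_of_nonneg_right f hf c c' hcc := by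
    rw [← Lp.coeFn_nonneg] at hf
    rw [← Lp.coeFn_le]
    filter_upwards [hf, Lp.coeFn_smul c f, Lp.coeFn_smul c' f] with x h1 h2 h3
    rw [h2, h3]
    exact mul_le_mul_of_nonneg_right hcc h1

/-- The classes of functions with values in `[0, 1]`. -/
def unitValued (μ : Measure X) : Set (Lp ℝ 2 μ) := {f | ∀ᵐ x ∂μ, f x ∈ Icc (0 : ℝ) 1}

lemma isClosed_unitValued : IsClosed (unitValued μ) := by
  refine IsSeqClosed.isClosed fun f f₀ hf hlim => ?_
  obtain ⟨φ, -, hφ⟩ := (tendstoInMeasure_of_tendsto_Lp hlim).exists_seq_tendsto_ae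
  have hf' : ∀ᵐ x ∂μ, ∀ n, f n x ∈ Icc (0 : ℝ) 1 := ae_all_iff.2 hf
  filter_upwards [hf', hφ] with x hx hφx
  exact isClosed_Icc.mem_of_tendsto hφx (Eventually.of_forall fun n => hx _)

lemma convex_unitValued : Convex ℝ (unitValued μ) := by
  intro f hf g hg a b ha hb hab
  filter_upwards [hf, hg, Lp.coeFn_add (a • f) (b • g), Lp.coeFn_smul a f, Lp.coeFn_smul b g]
    with x h1 h2 h3 h4 h5
  rw [h3, Pi.add_apply, h4, h5]
  exact convex_Icc 0 1 h1 h2 ha hb hab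

/-- An operator which maps `[0, 1]`-valued functions to `[0, 1]`-valued functions preserves
positivity. -/
lemma nonneg_of_mapsTo_unitValued {S : Lp ℝ 2 μ →L[ℝ] Lp ℝ 2 μ}
    (hS : ∀ f ∈ unitValued μ, S f ∈ unitValued μ) {f : Lp ℝ 2 μ} (hf : 0 ≤ f) : 0 ≤ S f := by
  have hd := Lp.simpleFunc.denseRange_coeSimpleFuncNonnegToLpNonneg 2 μ ℝ (by simp)
  have hcl : IsClosed {g : {g : Lp ℝ 2 μ // 0 ≤ g} | 0 ≤ S g} :=
    isClosed_le continuous_const (S.continuous.comp continuous_subtype_val)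
  refine (hd.induction_on (p := fun g => 0 ≤ S g) ⟨f, hf⟩ hcl ?_)
  intro g
  obtain ⟨g', hg', hgg'⟩ := Lp.simpleFunc.exists_simpleFunc_nonneg_ae_eq g.2
  obtain ⟨C, hC⟩ := g'.exists_forall_norm_le
  have hC' : 0 < |C| + 1 := by positivity
  have hmem : (|C| + 1)⁻¹ • ((g : Lp.simpleFunc ℝ 2 μ) : Lp ℝ 2 μ) ∈ unitValued μ := by
    filter_upwards [Lp.coeFn_smul (|C| + 1)⁻¹ ((g : Lp.simpleFunc ℝ 2 μ) : Lp ℝ 2 μ), hgg']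
      with x h1 h2
    have h3 : 0 ≤ g' x := hg' x
    have h4 : g' x ≤ |C| + 1 := by
      have := hC x
      rw [Real.norm_of_nonneg h3] at this
      linarith [le_abs_self C]
    rw [h1, Pi.smul_apply, h2, smul_eq_mul]
    refine ⟨by positivity, ?_⟩
    rw [inv_mul_le_iff₀ hC', mul_one]
    exact h4
  have h5 : 0 ≤ S ((|C| + 1)⁻¹ • ((g : Lp.simpleFunc ℝ 2 μ) : Lp ℝ 2 μ)) := by
    rw [← Lp.coeFn_nonneg]
    filter_upwards [hS _ hmem] with x hx
    exact hx.1
  have h6 := smul_nonneg hC'.le h5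
  rwa [map_smul, smul_inv_smul₀ hC'.ne'] at h6

lemma Lp.inner_nonneg {f g : Lp ℝ 2 μ} (hf : 0 ≤ f) (hg : 0 ≤ g) : 0 ≤ inner ℝ f g := by
  rw [L2.inner_def]
  rw [← Lp.coeFn_nonneg] at hf hg
  refine integral_nonneg_of_ae ?_
  filter_upwards [hf, hg] with x h1 h2
  exact mul_nonneg h2 h1

lemma Lp.inner_le_inner {f g g' : Lp ℝ 2 μ} (hf : 0 ≤ f) (hg : g ≤ g') :
    inner ℝ f g ≤ inner ℝ f g' := by
  have := Lp.inner_nonneg hf (sub_nonneg.2 hg)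
  rw [inner_sub_right] at this
  linarith

namespace IsFormOf

variable {i : V →L[ℝ] Lp ℝ 2 μ} {d : V →L[ℝ] F'} {D : Set (Lp ℝ 2 μ)}
  {B : Lp ℝ 2 μ → Lp ℝ 2 μ → ℝ} (h : IsFormOf i d D B) (hM : IsMarkovianForm D B)
  {R : ℝ → Lp ℝ 2 μ →L[ℝ] V} (hR : IsResolventMap i d R)
include h hM hR

/-- The resolvent of a Markovian form is Markovian: `α R_α f` minimizes
`q ↦ ‖d q‖² + α ‖i q - f‖²`, and the unit contraction does not increase this functional when `f`
has values in `[0, 1]`. -/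
lemma smul_resolvent_mem_unitValued {α : ℝ} (hα : 0 < α) {f : Lp ℝ 2 μ} (hf : f ∈ unitValued μ) :
    α • i (R α f) ∈ unitValued μ := by
  set p := α • R α f with hp
  have hip : i p = α • i (R α f) := map_smul _ _ _
  obtain ⟨v, hvD, hv, hB⟩ := hM (i p) (h.mem p)
  obtain ⟨q, rfl⟩ := h.exists_eq hvD
  have hEL : ∀ r, inner ℝ (d p) (d r) + α * inner ℝ (i p - f) (i r) = 0 := by
    intro r
    have := hR α hα f r
    rw [inner_sub_left, hp, map_smul, map_smul, real_inner_smul_left, real_inner_smul_left]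
    linear_combination α * this
  have h1 : ‖i q - f‖ ≤ ‖i p - f‖ := by
    refine Lp.norm_le_norm_of_ae_le ?_
    filter_upwards [hv, hf, Lp.coeFn_sub (i q) f, Lp.coeFn_sub (i p) f] with x h1 h2 h3 h4
    rw [h3, h4, Pi.sub_apply, Pi.sub_apply, h1, Real.norm_eq_abs, Real.norm_eq_abs]
    obtain ⟨h5, h6⟩ := h2
    rcases le_total (i p x) 0 with h7 | h7
    · rw [max_eq_left h7, min_eq_left zero_le_one, zero_sub, abs_neg, abs_of_nonneg h5,
        abs_of_nonpos (by linarith)]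
      linarith
    · rw [max_eq_right h7]
      rcases le_total (i p x) 1 with h8 | h8
      · rw [min_eq_left h8]
      · rw [min_eq_right h8, abs_of_nonneg (by linarith), abs_of_nonneg (by linarith)]
        linarith
  have h2 : ‖d q‖ ^ 2 ≤ ‖d p‖ ^ 2 := by
    rw [h.form, h.form, real_inner_self_eq_norm_sq, real_inner_self_eq_norm_sq] at hB
    exact hB
  have h3 : ‖i q - i p‖ ^ 2 ≤ 0 := by
    have e1 : ‖d q‖ ^ 2 = ‖d p‖ ^ 2 + 2 * inner ℝ (d p) (d (q - p)) + ‖d (q - p)‖ ^ 2 := by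
      rw [← norm_add_sq_real, ← map_add, add_sub_cancel]
    have e2 : ‖i q - f‖ ^ 2 = ‖i p - f‖ ^ 2 + 2 * inner ℝ (i p - f) (i (q - p)) +
        ‖i (q - p)‖ ^ 2 := by
      rw [← norm_add_sq_real, map_sub]; congr 2; abel
    have e3 := hEL (q - p)
    have e4 : ‖i q - f‖ ^ 2 ≤ ‖i p - f‖ ^ 2 := by gcongr
    rw [← map_sub]
    have e5 : 0 ≤ ‖d (q - p)‖ ^ 2 := by positivity
    have e6 : α * ‖i (q - p)‖ ^ 2 ≤ 0 := by nlinarith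
    by_contra! hcon
    nlinarith
  have h4 : i q = i p := by
    have : ‖i q - i p‖ ^ 2 = 0 := le_antisymm h3 (by positivity)
    exact sub_eq_zero.1 (norm_eq_zero.1 (pow_eq_zero_iff two_ne_zero |>.1 this))
  rw [← hip, ← h4]
  filter_upwards [hv] with x hx
  rw [hx]
  exact ⟨le_min (le_max_left _ _) zero_le_one, min_le_right _ _⟩

lemma resolvent_nonneg {α : ℝ} (hα : 0 < α) {f : Lp ℝ 2 μ} (hf : 0 ≤ f) : 0 ≤ i (R α f) := by
  have hS : ∀ g ∈ unitValued μ, (α • i.comp (R α)) g ∈ unitValued μ := fun g hg => by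
    rw [smul_apply, ContinuousLinearMap.comp_apply]
    exact h.smul_resolvent_mem_unitValued hM hR hα hg
  have h1 := nonneg_of_mapsTo_unitValued hS hf
  rw [smul_apply, ContinuousLinearMap.comp_apply] at h1
  have h2 := smul_nonneg (inv_nonneg.2 hα.le) h1
  rwa [inv_smul_smul₀ hα.ne'] at h2

lemma semigroup_mem_unitValued {T : ℝ → Lp ℝ 2 μ →L[ℝ] Lp ℝ 2 μ} (hT : IsSemigroupOfForm D B T)
    {t : ℝ} (ht : 0 ≤ t) {f : Lp ℝ 2 μ} (hf : f ∈ unitValued μ) : T t f ∈ unitValued μ := by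
  refine isClosed_unitValued.mem_of_tendsto
    (hT.isContractionSemigroup.tendsto_exp_yosida (h.isLaplaceTransform hR hT)
    (h.energySpace.isContractionResolvent hR) ht f) ?_
  filter_upwards [eventually_gt_atTop 0] with l hl
  have hS : ∀ g ∈ unitValued μ, l • (i.comp (R l)) g ∈ unitValued μ := fun g hg => by
    rw [ContinuousLinearMap.comp_apply]
    exact h.smul_resolvent_mem_unitValued hM hR hl hg
  exact exp_yosida_mem (G := fun α => i.comp (R α)) convex_unitValued isClosed_unitValued hl hS
    ht hf

lemma semigroup_nonneg {T : ℝ → Lp ℝ 2 μ →L[ℝ] Lp ℝ 2 μ} (hT : IsSemigroupOfForm D B T)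
    {t : ℝ} (ht : 0 ≤ t) {f : Lp ℝ 2 μ} (hf : 0 ≤ f) : 0 ≤ T t f :=
  nonneg_of_mapsTo_unitValued (fun _ hg => h.semigroup_mem_unitValued hM hR hT ht hg) hf

end IsFormOf

end Forms

/-! ### Recurrence and conservativeness -/

section Semigroups

variable {E : Type*} [NormedAddCommGroup E] [NormedSpace ℝ E] {T : ℝ → E →L[ℝ] E}

lemma IsContractionSemigroup.intervalIntegrable (hT : IsContractionSemigroup T) {t : ℝ}
    (ht : 0 ≤ t) (f : E) : IntervalIntegrable (fun s => T s f) volume 0 t := by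
  refine ((hT.continuous_max f).intervalIntegrable 0 t).congr fun s hs => ?_
  rw [uIoc_of_le ht] at hs
  simp only [max_eq_left hs.1.le]

/-- The time integral of a semigroup lies in the domain of its generator. -/
lemma IsContractionSemigroup.integral_eq_resolvent [CompleteSpace E] {G : ℝ → E →L[ℝ] E}
    (hT : IsContractionSemigroup T) (hL : IsLaplaceTransform T G) {t : ℝ} (ht : 0 ≤ t) (f : E) :
    ∫ s in (0 : ℝ)..t, T s f = G 1 ((∫ s in (0 : ℝ)..t, T s f) + f - T t f) := by
  have hd := fun s (hs : (0 : ℝ) ≤ s) =>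
    hT.hasDerivWithinAt_apply_resolvent hL one_pos hs f (Ici 0) subset_rfl
  have h1 : ∫ s in (0 : ℝ)..t, T s ((1 : ℝ) • G 1 f - f) = T t (G 1 f) - T 0 (G 1 f) :=
    intervalIntegral.integral_eq_sub_of_hasDeriv_right_of_le ht
      (fun s hs => (hd s hs.1).continuousWithinAt.mono Icc_subset_Ici_self)
      (fun s hs => (hd s hs.1.le).mono (Ioi_subset_Ici hs.1.le)) (hT.intervalIntegrable ht _)
  have h2 : ∫ s in (0 : ℝ)..t, T s ((1 : ℝ) • G 1 f - f) =
      G 1 (∫ s in (0 : ℝ)..t, T s f) - ∫ s in (0 : ℝ)..t, T s f := by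
    rw [← ContinuousLinearMap.intervalIntegral_comp_comm _ (hT.intervalIntegrable ht f),
      ← intervalIntegral.integral_sub]
    · refine intervalIntegral.integral_congr fun s hs => ?_
      rw [uIcc_of_le ht] at hs
      simp only [one_smul, map_sub, hT.comm_resolvent hL one_pos hs.1]
    · have := hT.intervalIntegrable ht f
      exact ⟨(G 1).integrable_comp this.1, (G 1).integrable_comp this.2⟩
    · exact hT.intervalIntegrable ht f
  rw [h2, hT.zero, hT.comm_resolvent hL one_pos ht] at h1
  change _ = _ - G 1 f at h1
  rw [map_sub, map_add]
  rw [sub_eq_sub_iff_add_eq_add] at h1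
  rw [h1]
  abel

end Semigroups

section EnergySpaces

variable {V F F' : Type*} [NormedAddCommGroup V] [InnerProductSpace ℝ V]
  [NormedAddCommGroup F] [InnerProductSpace ℝ F] [NormedAddCommGroup F'] [InnerProductSpace ℝ F']

/-- An element `f` whose energy integral `⟪f, R_α f⟫` stays bounded as `α → 0` acts on the domain
as a functional bounded by the square root of the form. -/
lemma IsResolventMap.inner_le {i : V →L[ℝ] F} {d : V →L[ℝ] F'} {R : ℝ → F →L[ℝ] V}
    (hR : IsResolventMap i d R) {f : F} {C : ℝ}
    (hC : ∀ α > 0, α ≤ 1 / 2 → inner ℝ f (i (R α f)) ≤ C) (q : V) :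
    inner ℝ f (i q) ≤ √C * ‖d q‖ := by
  have key : ∀ α > 0, α ≤ 1 / 2 → inner ℝ f (i q) ≤ √C * ‖d q‖ + √(α * C) * ‖i q‖ := by
    intro α hα hα2
    have h1 := hR α hα f (R α f)
    rw [real_inner_self_eq_norm_sq, real_inner_self_eq_norm_sq] at h1
    have h2 := hC α hα hα2
    have h3 : ‖d (R α f)‖ ≤ √C := Real.le_sqrt_of_sq_le (by
      have : 0 ≤ α * ‖i (R α f)‖ ^ 2 := by positivity
      linarith)
    have h4 : α * ‖i (R α f)‖ ≤ √(α * C) := Real.le_sqrt_of_sq_le (by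
      have : 0 ≤ ‖d (R α f)‖ ^ 2 := by positivity
      nlinarith)
    rw [← hR α hα f q]
    have h5 := real_inner_le_norm (d (R α f)) (d q)
    have h6 := real_inner_le_norm (i (R α f)) (i q)
    calc _ ≤ ‖d (R α f)‖ * ‖d q‖ + α * (‖i (R α f)‖ * ‖i q‖) := by gcongr
      _ = ‖d (R α f)‖ * ‖d q‖ + (α * ‖i (R α f)‖) * ‖i q‖ := by ring
      _ ≤ _ := by gcongr
  have hlim : Tendsto (fun α : ℝ => √C * ‖d q‖ + √(α * C) * ‖i q‖) (𝓝[>] 0) (𝓝 (√C * ‖d q‖)) := by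
    have : Continuous fun α : ℝ => √C * ‖d q‖ + √(α * C) * ‖i q‖ := by fun_prop
    simpa using (this.tendsto 0).mono_left nhdsWithin_le_nhds
  refine ge_of_tendsto hlim ?_
  filter_upwards [Ioc_mem_nhdsGT (by norm_num : (0 : ℝ) < 1 / 2)] with α hα
  exact key α hα.1 hα.2

end EnergySpaces

section Forms

variable {X : Type*} [TopologicalSpace X] [MeasurableSpace X] {μ : Measure X}

omit [TopologicalSpace X] in
lemma nonneg_of_mem_unitValued {f : Lp ℝ 2 μ} (hf : f ∈ unitValued μ) : 0 ≤ᵐ[μ] f := by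
  filter_upwards [hf] with x hx
  exact hx.1

/-- A sequence of `[0, 1]`-valued elements of the domain which are eventually `1` on every compact
set and whose energies tend to `0`. -/
structure IsUnitApproximation (D : Set (Lp ℝ 2 μ)) (B : Lp ℝ 2 μ → Lp ℝ 2 μ → ℝ)
    (u : ℕ → Lp ℝ 2 μ) : Prop where
  mem : ∀ n, u n ∈ D
  mem_unitValued : ∀ n, u n ∈ unitValued μ
  eventually_eq_one : ∀ K, IsCompact K → ∀ᶠ n in atTop, ∀ᵐ x ∂μ, x ∈ K → u n x = 1
  tendsto : Tendsto (fun n => B (u n) (u n)) atTop (𝓝 0)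

omit [TopologicalSpace X] in
lemma inner_indicator_toLp {A : Set X} (hA : MeasurableSet A) (f g : Lp ℝ 2 μ) :
    inner ℝ (((Lp.memLp f).indicator hA).toLp _) g = ∫ x in A, f x * g x ∂μ := by
  rw [L2.inner_def, ← integral_indicator hA]
  refine integral_congr_ae ?_
  filter_upwards [((Lp.memLp f).indicator hA).coeFn_toLp] with x hx
  rw [hx]
  by_cases hxA : x ∈ A <;> simp [hxA, mul_comm]

variable {V F' : Type*} [NormedAddCommGroup V] [InnerProductSpace ℝ V]
  [NormedAddCommGroup F'] [InnerProductSpace ℝ F']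

namespace IsFormOf

variable {i : V →L[ℝ] Lp ℝ 2 μ} {d : V →L[ℝ] F'} {D : Set (Lp ℝ 2 μ)}
  {B : Lp ℝ 2 μ → Lp ℝ 2 μ → ℝ} (h : IsFormOf i d D B) (hM : IsMarkovianForm D B)
  {R : ℝ → Lp ℝ 2 μ →L[ℝ] V} (hR : IsResolventMap i d R)
  {T : ℝ → Lp ℝ 2 μ →L[ℝ] Lp ℝ 2 μ} (hT : IsSemigroupOfForm D B T)
include h hM hR hT

omit [TopologicalSpace X] in
lemma integral_semigroup_le {t : ℝ} (ht : 0 ≤ t) {f : Lp ℝ 2 μ} (hf : 0 ≤ f) :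
    ∫ s in (0 : ℝ)..t, T s f ≤ Real.exp t • i (R 1 f) := by
  have hT' := hT.isContractionSemigroup
  have hi := hT'.integrableOn_exp_smul one_pos f
  have h1 : ∫ s in Ioc 0 t, T s f ≤ ∫ s in Ioc 0 t, Real.exp t • Real.exp (-1 * s) • T s f := by
    refine setIntegral_mono_on (hT'.intervalIntegrable ht f).1
      ((hi.mono_set Ioc_subset_Ioi_self).fun_smul (Real.exp t)) measurableSet_Ioc fun s hs => ?_
    rw [smul_smul, ← Real.exp_add]
    refine le_smul_of_one_le_left (h.semigroup_nonneg hM hR hT hs.1.le hf) ?_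
    exact Real.one_le_exp (by linarith [hs.2])
  have h2 : 0 ≤ ∫ s in Ioi t, Real.exp (-1 * s) • T s f := by
    refine integral_nonneg_of_ae ?_
    filter_upwards [ae_restrict_mem measurableSet_Ioi] with s hs
    exact smul_nonneg (Real.exp_pos _).le
      (h.semigroup_nonneg hM hR hT (ht.trans (le_of_lt hs)) hf)
  rw [intervalIntegral.integral_of_le ht]
  refine h1.trans ?_
  rw [integral_smul]
  refine smul_le_smul_of_nonneg_left ?_ (Real.exp_pos _).le
  have h3 := intervalIntegral.integral_interval_add_Ioi hi
    (hi.mono_set (Ioi_subset_Ioi ht))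
  rw [h.isLaplaceTransform hR hT 1 one_pos f, intervalIntegral.integral_of_le ht] at h3
  change _ = i (R 1 f) at h3
  rw [← h3]
  exact le_add_of_nonneg_right h2

omit [TopologicalSpace X] in
/-- A bound on the partial potentials of `f`, tested against `g`, bounds all resolvents, because
`e^{-αs} ≤ 1`. -/
lemma inner_resolvent_le {α : ℝ} (hα : 0 < α) {f g : Lp ℝ 2 μ} (hf : 0 ≤ f) (hg : 0 ≤ g) {C : ℝ}
    (hC : ∀ N : ℕ, inner ℝ g (∫ s in (0 : ℝ)..N, T s f) ≤ C) :
    inner ℝ g (i (R α f)) ≤ C := by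
  have hT' := hT.isContractionSemigroup
  have hi := hT'.integrableOn_exp_smul hα f
  have h1 := intervalIntegral_tendsto_integral_Ioi 0 hi tendsto_natCast_atTop_atTop
  rw [h.isLaplaceTransform hR hT α hα f] at h1
  refine le_of_tendsto (tendsto_const_nhds.inner h1 : Tendsto (fun N : ℕ =>
    inner ℝ g (∫ s in (0 : ℝ)..N, Real.exp (-α * s) • T s f)) _ _)
    (Eventually.of_forall fun N => ?_)
  refine le_trans (Lp.inner_le_inner hg ?_) (hC N)
  rw [intervalIntegral.integral_of_le N.cast_nonneg, intervalIntegral.integral_of_le N.cast_nonneg]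
  refine setIntegral_mono_on (hi.mono_set Ioc_subset_Ioi_self)
    (hT'.intervalIntegrable N.cast_nonneg f).1 measurableSet_Ioc fun s hs => ?_
  refine smul_le_of_le_one_left (h.semigroup_nonneg hM hR hT hs.1.le hf) ?_
  exact Real.exp_le_one_iff.2 (by nlinarith [hs.1])

/-- On a set of finite measure where all partial potentials of `f` are bounded, `R_1 f` vanishes:
its restriction to this set has a bounded energy integral, hence pairs to `0` with the functions
of a unit approximation. -/
lemma resolvent_eq_zero_of_bounded {u : ℕ → Lp ℝ 2 μ} (hu : IsUnitApproximation D B u)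
    {f : Lp ℝ 2 μ} (hf : 0 ≤ f) {A K : Set X} (hA : MeasurableSet A) (hK : IsCompact K)
    (hAK : A ⊆ K) (hμA : μ A ≠ ∞) {c : ℝ}
    (hc : ∀ N : ℕ, ∀ x ∈ A, (∫ s in (0 : ℝ)..N, T s f) x ≤ c) :
    ∀ᵐ x ∂μ, x ∈ A → i (R 1 f) x = 0 := by
  set f₁ := i (R 1 f) with hf₁
  have hf₁0 : 0 ≤ f₁ := h.resolvent_nonneg hM hR one_pos hf
  have hf₁0' := (Lp.coeFn_nonneg _).2 hf₁0
  set g : Lp ℝ 2 μ := ((Lp.memLp f₁).indicator hA).toLp _ with hg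
  have hgae : g =ᵐ[μ] A.indicator f₁ := ((Lp.memLp f₁).indicator hA).coeFn_toLp
  have hg0 : 0 ≤ g := by
    rw [← Lp.coeFn_nonneg]
    filter_upwards [hgae, hf₁0'] with x h1 h2
    rw [h1]
    exact indicator_nonneg (fun _ _ => h2) x
  have hgf : g ≤ f₁ := by
    rw [← Lp.coeFn_le]
    filter_upwards [hgae, hf₁0'] with x h1 h2
    rw [h1]
    exact indicator_le_self' (fun _ _ => h2) x
  set m := ∫ x in A, f₁ x ∂μ with hm
  have hint : IntegrableOn f₁ A μ :=
    integrableOn_Lp_of_measure_ne_top f₁ (by norm_num) hμA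
  have hS : ∀ N : ℕ, inner ℝ g (∫ s in (0 : ℝ)..N, T s f) ≤ c * m := by
    intro N
    rw [hg, inner_indicator_toLp hA, hm, ← integral_const_mul]
    refine setIntegral_mono_on_ae ?_ (hint.const_mul c) hA ?_
    · have := L2.integrable_inner (𝕜 := ℝ) (∫ s in (0 : ℝ)..N, T s f) f₁
      exact this.integrableOn
    · filter_upwards [hf₁0'] with x h1 hx
      rw [mul_comm]
      exact mul_le_mul_of_nonneg_right (hc N x hx) h1
  have hres : ∀ α > 0, α ≤ 1 / 2 → inner ℝ g (i (R α g)) ≤ 2 * (c * m) := by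
    intro α hα hα2
    have h1 : inner ℝ g (i (R α g)) ≤ inner ℝ g (i (R α f₁)) := by
      refine Lp.inner_le_inner hg0 (sub_nonneg.1 ?_)
      have := h.resolvent_nonneg hM hR hα (sub_nonneg.2 hgf)
      rwa [map_sub, map_sub] at this
    -- resolvent equation: `(1 - α) R_α R_1 f = R_α f - R_1 f ≤ R_α f`
    have h2 : (1 - α) * inner ℝ g (i (R α f₁)) ≤ inner ℝ g (i (R α f)) := by
      have h3 := (h.energySpace.isContractionResolvent hR).identity α hα 1 one_pos f
      change i (R α f) - f₁ = (1 - α) • i (R α f₁) at h3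
      rw [← real_inner_smul_right, ← h3]
      exact Lp.inner_le_inner hg0 (sub_le_self _ hf₁0)
    have h4 := h.inner_resolvent_le hM hR hT hα hf hg0 hS
    have h5 : 0 ≤ inner ℝ g (i (R α f₁)) :=
      Lp.inner_nonneg hg0 (h.resolvent_nonneg hM hR hα hf₁0)
    nlinarith
  have hlim : m ≤ 0 := by
    have hpair := hR.inner_le hres
    choose q hq using fun n => h.exists_eq (hu.mem n)
    have h1 : Tendsto (fun n => √(2 * (c * m)) * ‖d (q n)‖) atTop (𝓝 0) := by
      have h2 : Tendsto (fun n => ‖d (q n)‖) atTop (𝓝 0) := by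
        have h3 := hu.tendsto.sqrt
        simp only [← hq, h.form, real_inner_self_eq_norm_sq, Real.sqrt_sq (norm_nonneg _),
          Real.sqrt_zero] at h3
        exact h3
      simpa using h2.const_mul (√(2 * (c * m)))
    refine ge_of_tendsto h1 ?_
    filter_upwards [hu.eventually_eq_one K hK] with n hn
    refine le_of_eq_of_le ?_ (hpair (q n))
    rw [hq, hg, inner_indicator_toLp hA, hm]
    refine setIntegral_congr_ae hA ?_
    filter_upwards [hn] with x hx hxA
    rw [hx (hAK hxA), mul_one]
  have hnn : 0 ≤ᵐ[μ.restrict A] f₁ := ae_restrict_of_ae hf₁0'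
  have hm0 : m = 0 := le_antisymm hlim (integral_nonneg_of_ae hnn)
  have := (integral_eq_zero_iff_of_nonneg_ae hnn hint).1 hm0
  exact (ae_restrict_iff' hA).1 this

variable [SigmaCompactSpace X] [T2Space X] [OpensMeasurableSpace X] [IsFiniteMeasureOnCompacts μ]

/-- The potential of a non-negative square integrable function takes only the values `0` and `∞`:
on the set where it is bounded by `k`, intersected with a compact set, `R_1 f` vanishes, and
`∫₀ᴺ T_s f ds ≤ e^N R_1 f`. -/
lemma iSup_integral_semigroup {u : ℕ → Lp ℝ 2 μ} (hu : IsUnitApproximation D B u)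
    {f : Lp ℝ 2 μ} (hf : 0 ≤ f) :
    ∀ᵐ x ∂μ, (⨆ N : ℕ, ENNReal.ofReal ((∫ s in (0 : ℝ)..N, T s f) x)) = 0 ∨
      (⨆ N : ℕ, ENNReal.ofReal ((∫ s in (0 : ℝ)..N, T s f) x)) = ⊤ := by
  set S : ℕ → Lp ℝ 2 μ := fun N => ∫ s in (0 : ℝ)..N, T s f
  set P : X → ℝ≥0∞ := fun x => ⨆ N, ENNReal.ofReal (S N x)
  have hP : Measurable P := Measurable.iSup fun N =>
    (Lp.stronglyMeasurable (S N)).measurable.ennreal_ofReal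
  have h1 : ∀ᵐ x ∂μ, ∀ k m : ℕ, x ∈ {x | P x ≤ k} ∩ compactCovering X m → i (R 1 f) x = 0 := by
    refine ae_all_iff.2 fun k => ae_all_iff.2 fun m => ?_
    have hK := isCompact_compactCovering X m
    refine h.resolvent_eq_zero_of_bounded hM hR hT hu hf
      ((measurableSet_le hP measurable_const).inter hK.measurableSet) hK inter_subset_right
      (measure_mono inter_subset_right |>.trans_lt hK.measure_lt_top).ne (c := k) ?_
    intro N x hx
    have h2 : ENNReal.ofReal (S N x) ≤ k := (le_iSup (fun N => ENNReal.ofReal (S N x)) N).trans hx.1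
    exact (ENNReal.ofReal_le_natCast).1 h2
  have h2 : ∀ᵐ x ∂μ, ∀ N : ℕ, S N x ≤ Real.exp N * i (R 1 f) x := by
    refine ae_all_iff.2 fun N => ?_
    have h3 := (Lp.coeFn_le _ _).2 (h.integral_semigroup_le hM hR hT N.cast_nonneg hf)
    filter_upwards [h3, Lp.coeFn_smul (Real.exp N) (i (R 1 f))] with x h4 h5
    rw [h5] at h4
    exact h4
  filter_upwards [h1, h2] with x h3 h4
  rw [or_iff_not_imp_right]
  intro hx
  obtain ⟨k, hk⟩ := ENNReal.exists_nat_gt hx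
  obtain ⟨m, hm⟩ := exists_mem_compactCovering x
  have h5 := h3 k m ⟨hk.le, hm⟩
  refine le_antisymm (iSup_le fun N => ?_) zero_le
  have h6 := h4 N
  rw [h5, mul_zero] at h6
  rw [ENNReal.ofReal_of_nonpos h6]

end IsFormOf

omit [TopologicalSpace X] in
lemma toL2_nonneg {f : X → ℝ} (hf : 0 ≤ f) : 0 ≤ toL2 μ f := by
  rw [toL2]
  split_ifs with hm
  · rw [← Lp.coeFn_nonneg]
    filter_upwards [hm.coeFn_toLp] with x hx
    rw [hx]
    exact hf x
  · exact le_rfl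

variable [CompleteSpace V] [CompleteSpace F']

/-- A Markovian form with a unit approximation is recurrent. -/
theorem IsFormOf.isRecurrentForm [SigmaCompactSpace X] [T2Space X] [OpensMeasurableSpace X]
    [IsFiniteMeasureOnCompacts μ] {i : V →L[ℝ] Lp ℝ 2 μ} {d : V →L[ℝ] F'} {D : Set (Lp ℝ 2 μ)}
    {B : Lp ℝ 2 μ → Lp ℝ 2 μ → ℝ} (h : IsFormOf i d D B) (hM : IsMarkovianForm D B)
    {u : ℕ → Lp ℝ 2 μ} (hu : IsUnitApproximation D B u) : IsRecurrentForm D B := by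
  refine ⟨h.exists_isSemigroupOfForm, fun T hT f _ _ => ?_⟩
  obtain ⟨R, hR⟩ := h.energySpace.exists_resolventMap
  have h1 : ∀ᵐ x ∂μ, ∀ n : ℕ,
      (⨆ N : ℕ, ENNReal.ofReal ((∫ s in (0 : ℝ)..N, T s (toL2 μ (cutoff f n))) x)) = 0 ∨
      (⨆ N : ℕ, ENNReal.ofReal ((∫ s in (0 : ℝ)..N, T s (toL2 μ (cutoff f n))) x)) = ⊤ := by
    refine ae_all_iff.2 fun n => h.iSup_integral_semigroup hM hR hT hu (toL2_nonneg fun x => ?_)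
    exact indicator_nonneg (fun _ _ => NNReal.coe_nonneg _) x
  filter_upwards [h1] with x hx
  rw [potential, iSup_comm]
  by_cases hex : ∃ n : ℕ,
      (⨆ N : ℕ, ENNReal.ofReal ((∫ s in (0 : ℝ)..N, T s (toL2 μ (cutoff f n))) x)) = ⊤
  · obtain ⟨n, hn⟩ := hex
    refine Or.inr (top_le_iff.1 ?_)
    rw [← hn]
    exact le_iSup (fun n : ℕ =>
      (⨆ N : ℕ, ENNReal.ofReal ((∫ s in (0 : ℝ)..N, T s (toL2 μ (cutoff f n))) x))) n
  · left
    push Not at hex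
    exact le_antisymm (iSup_le fun n => ((hx n).resolve_right (hex n)).le) zero_le

/-- A Markovian form with a unit approximation is conservative. -/
theorem IsFormOf.isConservativeForm [SigmaCompactSpace X] [T2Space X] [OpensMeasurableSpace X]
    [IsFiniteMeasureOnCompacts μ] {i : V →L[ℝ] Lp ℝ 2 μ} {d : V →L[ℝ] F'} {D : Set (Lp ℝ 2 μ)}
    {B : Lp ℝ 2 μ → Lp ℝ 2 μ → ℝ} (h : IsFormOf i d D B) (hM : IsMarkovianForm D B)
    {u : ℕ → Lp ℝ 2 μ} (hu : IsUnitApproximation D B u) : IsConservativeForm D B := by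
  refine ⟨h.exists_isSemigroupOfForm, fun T hT t ht => ?_⟩
  obtain ⟨R, hR⟩ := h.energySpace.exists_resolventMap
  have hT' := hT.isContractionSemigroup
  have hL := h.isLaplaceTransform hR hT
  have hK := isCompact_compactCovering X
  have hKm : ∀ n, MeasurableSet (compactCovering X n) := fun n => (hK n).measurableSet
  have hKf : ∀ n, μ (compactCovering X n) ≠ ∞ := fun n => (hK n).measure_lt_top.ne
  set c : ℕ → Lp ℝ 2 μ := fun n => toL2 μ (cutoff (fun _ => 1) n) with hc
  let e : ℕ → Lp ℝ 2 μ := fun n => indicatorConstLp 2 (hKm n) (hKf n) (1 : ℝ)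
  -- for `n ≥ 1` the truncations of the constant `1` are the indicators of the compact covering
  have hce : ∀ n, 1 ≤ n → c n = e n := by
    intro n hn
    have h1 : cutoff (fun _ : X => (1 : ℝ≥0)) n =
        (compactCovering X n).indicator fun _ => (1 : ℝ) := by
      have : min (1 : ℝ≥0) n = 1 := min_eq_left (by exact_mod_cast hn)
      simp [cutoff, this]
    have h2 : MemLp ((compactCovering X n).indicator fun _ => (1 : ℝ)) 2 μ :=
      memLp_indicator_const 2 (hKm n) 1 (Or.inr (hKf n))
    change toL2 μ _ = _
    rw [h1, toL2, dif_pos h2]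
    rfl
  have heu : ∀ n, e n ∈ unitValued μ := by
    intro n
    filter_upwards [indicatorConstLp_coeFn (p := 2) (hs := hKm n) (hμs := hKf n) (c := (1 : ℝ))]
      with x hx
    rw [hx]
    by_cases hxn : x ∈ compactCovering X n <;> simp [hxn]
  have hcu : ∀ n, c n ∈ unitValued μ := by
    intro n
    rcases Nat.eq_zero_or_pos n with rfl | hn
    · have h1 : cutoff (fun _ : X => (1 : ℝ≥0)) 0 = 0 := by
        ext x; simp [cutoff]
      have h2 : c 0 = 0 := by
        change toL2 μ _ = _
        rw [h1, toL2, dif_pos MemLp.zero]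
        exact MemLp.toLp_zero _
      rw [h2]
      filter_upwards [Lp.coeFn_zero ℝ 2 μ] with x hx
      rw [hx]; simp
    · rw [hce n hn]; exact heu n
  set P : X → ℝ≥0∞ := extendMonotone (T t) (fun _ => 1) with hP
  have hPdef : ∀ x, P x = ⨆ n, ENNReal.ofReal (T t (c n) x) := fun x => rfl
  have hP1 : ∀ᵐ x ∂μ, P x ≤ 1 := by
    have h1 : ∀ᵐ x ∂μ, ∀ n, T t (c n) x ∈ Icc (0 : ℝ) 1 := ae_all_iff.2 fun n =>
      h.semigroup_mem_unitValued hM hR hT ht.le (hcu n)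
    filter_upwards [h1] with x hx
    exact iSup_le fun n => ENNReal.ofReal_le_one.2 (hx n).2
  -- `T_t` preserves the integral of the indicator of a compact set
  have hmass : ∀ m, μ (compactCovering X m) ≤ ∫⁻ x, ENNReal.ofReal (T t (e m) x) ∂μ := by
    intro m
    set w := ∫ s in (0 : ℝ)..t, T s (e m) with hw
    have hwi := hT'.integral_eq_resolvent hL ht.le (e m)
    rw [← hw] at hwi
    change w = i (R 1 (w + e m - T t (e m))) at hwi
    choose q hq using fun n => h.exists_eq (hu.mem n)
    have h1 : ∀ n, inner ℝ (e m) (u n) - inner ℝ (T t (e m)) (u n) =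
        inner ℝ (d (R 1 (w + e m - T t (e m)))) (d (q n)) := by
      intro n
      have h2 := hR 1 one_pos (w + e m - T t (e m)) (q n)
      rw [← hwi, hq, inner_sub_left, inner_add_left] at h2
      linarith
    have h2 : Tendsto (fun n => inner ℝ (e m) (u n) - inner ℝ (T t (e m)) (u n)) atTop (𝓝 0) := by
      simp only [h1]
      have h3 : Tendsto (fun n => ‖d (q n)‖) atTop (𝓝 0) := by
        have h3 := hu.tendsto.sqrt
        simp only [← hq, h.form, real_inner_self_eq_norm_sq, Real.sqrt_sq (norm_nonneg _),
          Real.sqrt_zero] at h3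
        exact h3
      refine squeeze_zero_norm (fun n => abs_real_inner_le_norm _ _) ?_
      simpa using h3.const_mul ‖d (R 1 (w + e m - T t (e m)))‖
    have h3 : Tendsto (fun n => inner ℝ (T t (e m)) (u n)) atTop
        (𝓝 (μ.real (compactCovering X m))) := by
      have h4 : Tendsto (fun n => inner ℝ (e m) (u n)) atTop
          (𝓝 (μ.real (compactCovering X m))) := by
        refine tendsto_const_nhds.congr' ?_
        filter_upwards [hu.eventually_eq_one _ (hK m)] with n hn
        rw [L2.inner_indicatorConstLp_one, setIntegral_congr_ae (hKm m) hn]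
        simp
      simpa using h4.sub h2
    have hTe := h.semigroup_mem_unitValued hM hR hT ht.le (heu m)
    have h5 : Tendsto (fun n => ENNReal.ofReal (inner ℝ (T t (e m)) (u n))) atTop
        (𝓝 (μ (compactCovering X m))) := by
      have := ENNReal.tendsto_ofReal h3
      rwa [ofReal_measureReal (hKf m)] at this
    refine le_of_tendsto' h5 fun n => ?_
    rw [L2.inner_def, integral_eq_lintegral_of_nonneg_ae]
    · refine ENNReal.ofReal_toReal_le.trans (lintegral_mono_ae ?_)
      filter_upwards [hTe, hu.mem_unitValued n] with x h6 h7
      refine ENNReal.ofReal_le_ofReal ?_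
      change u n x * T t (e m) x ≤ _
      nlinarith [h6.1, h7.2]
    · filter_upwards [hTe, hu.mem_unitValued n] with x h6 h7
      exact mul_nonneg h7.1 h6.1
    · exact (L2.integrable_inner (𝕜 := ℝ) _ _).aestronglyMeasurable
  have hPm : Measurable P := Measurable.iSup fun n =>
    (Lp.stronglyMeasurable (T t (c n))).measurable.ennreal_ofReal
  have hmain : ∀ m, ∀ᵐ x ∂μ, x ∈ compactCovering X m → P x = 1 := by
    intro m
    have hTe := h.semigroup_mem_unitValued hM hR hT ht.le (heu m)
    -- by symmetry of `T_t`, the integral of `T_t 1` over `K_m` is the integral of `T_t 1_{K_m}`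
    have h1 : ∀ n, 1 ≤ n → ∫⁻ x in compactCovering X n, ENNReal.ofReal (T t (e m) x) ∂μ ≤
        ∫⁻ x in compactCovering X m, P x ∂μ := by
      intro n hn
      have hTn := h.semigroup_mem_unitValued hM hR hT ht.le (heu n)
      have h2 := hT.symm t ht.le (e n) (e m)
      rw [real_inner_comm, L2.inner_indicatorConstLp_one, L2.inner_indicatorConstLp_one] at h2
      rw [← ofReal_integral_eq_lintegral_ofReal
        (integrableOn_Lp_of_measure_ne_top _ (by norm_num) (hKf n))
        (ae_restrict_of_ae (nonneg_of_mem_unitValued hTe)), ← h2,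
        ofReal_integral_eq_lintegral_ofReal
        (integrableOn_Lp_of_measure_ne_top _ (by norm_num) (hKf m))
        (ae_restrict_of_ae (nonneg_of_mem_unitValued hTn))]
      refine lintegral_mono fun x => ?_
      rw [hPdef, ← hce n hn]
      exact le_iSup (fun n => ENNReal.ofReal (T t (c n) x)) n
    have h2 : ∫⁻ x, ENNReal.ofReal (T t (e m) x) ∂μ ≤ ∫⁻ x in compactCovering X m, P x ∂μ := by
      have h3 : ∫⁻ x, ENNReal.ofReal (T t (e m) x) ∂μ =
          ⨆ n, ∫⁻ x in compactCovering X n, ENNReal.ofReal (T t (e m) x) ∂μ := by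
        rw [← setLIntegral_iUnion_of_directed _
          (directed_of_isDirected_le (compactCovering_subset X)), iUnion_compactCovering,
          setLIntegral_univ]
      rw [h3]
      refine iSup_le fun n => ?_
      refine le_trans ?_ (h1 (n + 1) (by omega))
      exact lintegral_mono_set (compactCovering_subset X n.le_succ)
    have h4 : P =ᵐ[μ.restrict (compactCovering X m)] fun _ => 1 := by
      refine ae_eq_of_ae_le_of_lintegral_le (ae_restrict_of_ae hP1) ?_ aemeasurable_const ?_
      · refine ((lintegral_mono_ae (ae_restrict_of_ae hP1)).trans_lt ?_).ne
        rw [setLIntegral_const, one_mul]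
        exact (hK m).measure_lt_top
      · rw [setLIntegral_const, one_mul]
        exact (hmass m).trans h2
    exact (ae_restrict_iff' (hKm m)).1 h4
  filter_upwards [ae_all_iff.2 hmain] with x hx
  obtain ⟨m, hm⟩ := exists_mem_compactCovering x
  exact hx m hm

end Forms

/-! ### Weighted Sobolev spaces -/

section Weights

/-- Positive finite weights on the plane which are locally integrable together with their
reciprocals. -/
structure IsAdmissibleWeight (ρ : Plane → ℝ≥0∞) : Prop where
  measurable : Measurable ρ
  ne_zero : ∀ x, ρ x ≠ 0
  ne_top : ∀ x, ρ x ≠ ∞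
  locallyIntegrable : LocallyIntegrable (fun x => (ρ x).toReal) volume
  locallyIntegrable_inv : LocallyIntegrable (fun x => (ρ x)⁻¹.toReal) volume

/-- The measure with density `ρ`. -/
abbrev weightedMeasure (ρ : Plane → ℝ≥0∞) : Measure Plane := volume.withDensity ρ

/-- The reciprocal weight, as a real function. -/
def invWeight (ρ : Plane → ℝ≥0∞) (x : Plane) : ℝ := (ρ x)⁻¹.toReal

namespace IsAdmissibleWeight

variable {ρ : Plane → ℝ≥0∞} (hρ : IsAdmissibleWeight ρ)
include hρ

lemma isFiniteMeasureOnCompacts : IsFiniteMeasureOnCompacts (weightedMeasure ρ) where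
  lt_top_of_isCompact K hK := by
    have h1 := (locallyIntegrable_iff.1 hρ.locallyIntegrable K hK).2
    rw [hasFiniteIntegral_iff_enorm] at h1
    rw [withDensity_apply _ hK.measurableSet]
    refine lt_of_eq_of_lt (lintegral_congr fun x => ?_) h1
    rw [Real.enorm_eq_ofReal ENNReal.toReal_nonneg, ENNReal.ofReal_toReal (hρ.ne_top x)]

lemma volume_absolutelyContinuous : volume ≪ weightedMeasure ρ :=
  withDensity_absolutelyContinuous' hρ.measurable.aemeasurable
    (Eventually.of_forall hρ.ne_zero)

lemma ae_iff {p : Plane → Prop} : (∀ᵐ x ∂weightedMeasure ρ, p x) ↔ ∀ᵐ x, p x :=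
  ⟨fun h => hρ.volume_absolutelyContinuous.ae_le h,
    fun h => (withDensity_absolutelyContinuous _ _).ae_le h⟩

lemma withDensity_inv : (weightedMeasure ρ).withDensity (fun x => (ρ x)⁻¹) = volume :=
  withDensity_inv_same hρ.measurable (Eventually.of_forall hρ.ne_zero)
    (Eventually.of_forall hρ.ne_top)

lemma inv_lt_top : ∀ᵐ x ∂weightedMeasure ρ, (ρ x)⁻¹ < ∞ :=
  Eventually.of_forall fun x => ENNReal.inv_lt_top.2 (pos_iff_ne_zero.2 (hρ.ne_zero x))

lemma measurable_invWeight : Measurable (invWeight ρ) := hρ.measurable.inv.ennreal_toReal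

/-- Integration for the Lebesgue measure, expressed through the weighted measure. -/
lemma integrable_volume_iff {E : Type*} [NormedAddCommGroup E] [NormedSpace ℝ E]
    {F : Plane → E} :
    Integrable F volume ↔ Integrable (fun x => invWeight ρ x • F x) (weightedMeasure ρ) := by
  conv_lhs => rw [← hρ.withDensity_inv]
  exact integrable_withDensity_iff_integrable_smul' hρ.measurable.inv hρ.inv_lt_top

lemma integral_volume {E : Type*} [NormedAddCommGroup E] [NormedSpace ℝ E] (F : Plane → E) :
    ∫ x, F x = ∫ x, invWeight ρ x • F x ∂weightedMeasure ρ := by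
  conv_lhs => rw [← hρ.withDensity_inv]
  exact integral_withDensity_eq_integral_toReal_smul hρ.measurable.inv hρ.inv_lt_top F

lemma memLp_indicator_invWeight {K : Set Plane} (hK : IsCompact K) :
    MemLp (K.indicator (invWeight ρ)) 2 (weightedMeasure ρ) := by
  refine (memLp_two_iff_integrable_sq
    (hρ.measurable_invWeight.indicator hK.measurableSet).aestronglyMeasurable).2 ?_
  have h1 : Integrable (K.indicator (invWeight ρ)) volume :=
    (locallyIntegrable_iff.1 hρ.locallyIntegrable_inv K hK).integrable_indicator hK.measurableSet
  refine (hρ.integrable_volume_iff.1 h1).congr (Eventually.of_forall fun x => ?_)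
  by_cases hx : x ∈ K <;> simp [hx, sq]

variable {E : Type*} [NormedAddCommGroup E] [InnerProductSpace ℝ E]

lemma memLp_invWeight_smul {Ψ : Plane → E} (hΨ : Continuous Ψ) (hc : HasCompactSupport Ψ) :
    MemLp (fun x => invWeight ρ x • Ψ x) 2 (weightedMeasure ρ) := by
  obtain ⟨C, hC⟩ := hΨ.bounded_above_of_compact_support hc
  refine (hρ.memLp_indicator_invWeight hc).of_le_mul (c := C)
    (hρ.measurable_invWeight.aestronglyMeasurable.smul hΨ.aestronglyMeasurable)
    (Eventually.of_forall fun x => ?_)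
  by_cases hx : x ∈ tsupport Ψ
  · rw [indicator_of_mem hx, norm_smul, mul_comm]
    gcongr
    exact hC x
  · simp [hx, image_eq_zero_of_notMem_tsupport hx]

/-- Integration against a compactly supported function is a continuous functional on the weighted
`L²` space. -/
lemma inner_invWeight_smul {Ψ : Plane → E} (hΨ : Continuous Ψ) (hc : HasCompactSupport Ψ)
    (f : Lp E 2 (weightedMeasure ρ)) :
    inner ℝ f ((hρ.memLp_invWeight_smul hΨ hc).toLp _) = ∫ x, inner ℝ (f x) (Ψ x) := by
  rw [L2.inner_def, hρ.integral_volume]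
  refine integral_congr_ae ?_
  filter_upwards [(hρ.memLp_invWeight_smul hΨ hc).coeFn_toLp] with x hx
  rw [hx, real_inner_smul_right, smul_eq_mul]

lemma locallyIntegrable_Lp (f : Lp E 2 (weightedMeasure ρ)) : LocallyIntegrable f volume := by
  refine locallyIntegrable_iff.2 fun K hK => ?_
  rw [← integrable_indicator_iff hK.measurableSet, hρ.integrable_volume_iff]
  have h1 := (Lp.memLp f).norm.integrable_mul (hρ.memLp_indicator_invWeight hK)
  refine h1.mono (hρ.measurable_invWeight.aestronglyMeasurable.smul
    ((Lp.aestronglyMeasurable f).indicator hK.measurableSet)) (Eventually.of_forall fun x => ?_)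
  by_cases hx : x ∈ K <;> simp [hx, norm_smul, mul_comm]

end IsAdmissibleWeight

end Weights

/-! ### Weak gradients -/

section WeakGradients

/-- The ambient Hilbert space of pairs (function, gradient). -/
abbrev PairSpace (ρ : Plane → ℝ≥0∞) : Type :=
  WithLp 2 (Lp ℝ 2 (weightedMeasure ρ) × Lp Plane 2 (weightedMeasure ρ))

lemma IsTestFunction.continuous {φ : Plane → ℝ} (hφ : IsTestFunction φ) : Continuous φ :=
  hφ.1.continuous

lemma IsTestFunction.differentiable {φ : Plane → ℝ} (hφ : IsTestFunction φ) :
    Differentiable ℝ φ :=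
  hφ.1.differentiable (by simp)

lemma IsTestFunction.continuous_smul_const {φ : Plane → ℝ} (hφ : IsTestFunction φ) (e : Plane) :
    Continuous fun x => φ x • e :=
  hφ.continuous.smul continuous_const

lemma IsTestFunction.hasCompactSupport_smul_const {φ : Plane → ℝ} (hφ : IsTestFunction φ)
    (e : Plane) : HasCompactSupport fun x => φ x • e :=
  hφ.2.smul_right (f' := fun _ => e)

lemma IsTestFunction.continuous_fderiv {φ : Plane → ℝ} (hφ : IsTestFunction φ) (e : Plane) :
    Continuous fun x => fderiv ℝ φ x e :=
  (hφ.1.continuous_fderiv (by simp)).clm_apply continuous_const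

lemma IsTestFunction.continuous_gradient {φ : Plane → ℝ} (hφ : IsTestFunction φ) :
    Continuous (gradient φ) :=
  (InnerProductSpace.toDual ℝ Plane).symm.continuous.comp (hφ.1.continuous_fderiv (by simp))

lemma IsTestFunction.hasCompactSupport_gradient {φ : Plane → ℝ} (hφ : IsTestFunction φ) :
    HasCompactSupport (gradient φ) :=
  (hφ.2.fderiv (𝕜 := ℝ)).comp_left (map_zero (InnerProductSpace.toDual ℝ Plane).symm)

lemma IsTestFunction.integral_fderiv {φ : Plane → ℝ} (hφ : IsTestFunction φ) (e : Plane) :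
    ∫ x, fderiv ℝ φ x e = 0 := by
  have h1 := (hφ.continuous_fderiv e).integrable_of_hasCompactSupport (μ := volume)
    (hφ.2.fderiv_apply (𝕜 := ℝ) e)
  have h2 := hφ.continuous.integrable_of_hasCompactSupport (μ := volume) hφ.2
  have h := integral_mul_fderiv_eq_neg_fderiv_mul_of_integrable (μ := (volume : Measure Plane))
    (f := fun _ => (1 : ℝ)) (g := φ) (v := e) (by simp)
    (by simpa using h1) (by simpa using h2)
    (fun _ _ => differentiableAt_const _) (fun x _ => hφ.differentiable x)
  simpa using h

/-- The classical gradient of a test function is its weak gradient. -/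
lemma IsTestFunction.hasWeakGradient {φ : Plane → ℝ} (hφ : IsTestFunction φ) :
    HasWeakGradient φ (gradient φ) where
  locallyIntegrable := hφ.continuous.locallyIntegrable
  locallyIntegrable_grad := hφ.continuous_gradient.locallyIntegrable
  integral_eq ψ hψ e := by
    simp only [inner_gradient_left]
    refine integral_mul_fderiv_eq_neg_fderiv_mul_of_integrable ?_ ?_ ?_
      (fun x _ => hφ.differentiable x) (fun x _ => hψ.differentiable x)
    · exact ((hφ.continuous_fderiv e).mul hψ.continuous).integrable_of_hasCompactSupport
        hψ.2.mul_left
    · exact (hφ.continuous.mul (hψ.continuous_fderiv e)).integrable_of_hasCompactSupport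
        hφ.2.mul_right
    · exact (hφ.continuous.mul hψ.continuous).integrable_of_hasCompactSupport hψ.2.mul_left

lemma HasWeakGradient.congr {u u' : Plane → ℝ} {g g' : Plane → Plane} (h : HasWeakGradient u g)
    (hu : u =ᵐ[volume] u') (hg : g =ᵐ[volume] g') : HasWeakGradient u' g' where
  locallyIntegrable := h.locallyIntegrable.congr hu
  locallyIntegrable_grad := h.locallyIntegrable_grad.congr hg
  integral_eq φ hφ e := by
    rw [← integral_congr_ae (hu.mono fun x hx => by simp only [hx] :
        (fun x => u x * fderiv ℝ φ x e) =ᵐ[volume] fun x => u' x * fderiv ℝ φ x e),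
      h.integral_eq φ hφ e]
    exact congrArg _ (integral_congr_ae (hg.mono fun x hx => by simp only [hx]))

/-- The weak gradient vanishes almost everywhere on every open set on which the function is
constant. -/
lemma HasWeakGradient.ae_eq_zero {u : Plane → ℝ} {g : Plane → Plane} (h : HasWeakGradient u g)
    {U : Set Plane} (hU : IsOpen U) {c : ℝ} (hc : ∀ᵐ x, x ∈ U → u x = c) :
    ∀ᵐ x, x ∈ U → g x = 0 := by
  refine hU.ae_eq_zero_of_integral_contDiff_smul_eq_zero
    (h.locallyIntegrable_grad.locallyIntegrableOn U) fun φ hφ hφc hφU => ?_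
  have hφ' : IsTestFunction φ := ⟨hφ, hφc⟩
  have hint : Integrable (fun x => φ x • g x) volume :=
    h.locallyIntegrable_grad.integrable_smul_left_of_hasCompactSupport hφ.continuous hφc
  refine ext_inner_left ℝ fun e => ?_
  rw [← integral_inner hint, inner_zero_right]
  have h1 := h.integral_eq φ hφ' e
  have h2 : ∫ x, u x * fderiv ℝ φ x e = ∫ x, c * fderiv ℝ φ x e := by
    refine integral_congr_ae (hc.mono fun x hx => ?_)
    by_cases hxU : x ∈ tsupport φ
    · simp only [hx (hφU hxU)]
    · have : fderiv ℝ φ x = 0 := image_eq_zero_of_notMem_tsupport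
        (fun h => hxU (tsupport_fderiv_subset ℝ h))
      simp [this]
  rw [h2, integral_const_mul, hφ'.integral_fderiv e, mul_zero] at h1
  rw [← neg_eq_zero, h1]
  congr 1
  refine integral_congr_ae (Eventually.of_forall fun x => ?_)
  simp only [real_inner_smul_right, real_inner_comm e, mul_comm]

/-- Uniqueness of the weak gradient. -/
lemma HasWeakGradient.unique {u : Plane → ℝ} {g g' : Plane → Plane} (h : HasWeakGradient u g)
    (h' : HasWeakGradient u g') : g =ᵐ[volume] g' := by
  refine ae_eq_of_integral_contDiff_smul_eq h.locallyIntegrable_grad h'.locallyIntegrable_grad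
    fun φ hφ hφc => ext_inner_left ℝ fun e => ?_
  have hint : ∀ {g}, HasWeakGradient u g → inner ℝ e (∫ x, φ x • g x) =
      -∫ x, u x * fderiv ℝ φ x e := by
    intro g h
    rw [← integral_inner (h.locallyIntegrable_grad.integrable_smul_left_of_hasCompactSupport
      hφ.continuous hφc), h.integral_eq φ ⟨hφ, hφc⟩ e, neg_neg]
    refine integral_congr_ae (Eventually.of_forall fun x => ?_)
    simp only [real_inner_smul_right, real_inner_comm e, mul_comm]
  rw [hint h, hint h']

lemma HasWeakGradient.ae_eq_weakGradient {u : Plane → ℝ} {g : Plane → Plane}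
    (h : HasWeakGradient u g) : weakGradient u =ᵐ[volume] g := by
  have hex : ∃ g, HasWeakGradient u g := ⟨g, h⟩
  rw [weakGradient, dif_pos hex]
  exact hex.choose_spec.unique h

namespace IsAdmissibleWeight

variable {ρ : Plane → ℝ≥0∞} (hρ : IsAdmissibleWeight ρ)
include hρ

/-- For pairs of square integrable functions, integration by parts is an identity between continuous
functionals on the Hilbert space. -/
lemma hasWeakGradient_iff (z : PairSpace ρ) : HasWeakGradient z.fst z.snd ↔
    ∀ (φ) (hφ : IsTestFunction φ) (e : Plane),
      inner ℝ z.fst ((hρ.memLp_invWeight_smul (hφ.continuous_fderiv e)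
        (hφ.2.fderiv_apply (𝕜 := ℝ) e)).toLp _) =
      -inner ℝ z.snd ((hρ.memLp_invWeight_smul (hφ.continuous_smul_const e)
        (hφ.hasCompactSupport_smul_const e)).toLp _) := by
  have e1 : ∀ (φ) (hφ : IsTestFunction φ) (e : Plane), inner ℝ z.fst ((hρ.memLp_invWeight_smul
      (hφ.continuous_fderiv e) (hφ.2.fderiv_apply (𝕜 := ℝ) e)).toLp _) =
      ∫ x, z.fst x * fderiv ℝ φ x e := fun φ hφ e =>
    (hρ.inner_invWeight_smul (hφ.continuous_fderiv e) (hφ.2.fderiv_apply (𝕜 := ℝ) e) z.fst).trans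
      (integral_congr_ae (Eventually.of_forall fun x => mul_comm (fderiv ℝ φ x e) (z.fst x)))
  have e2 : ∀ (φ) (hφ : IsTestFunction φ) (e : Plane), inner ℝ z.snd ((hρ.memLp_invWeight_smul
      (hφ.continuous_smul_const e)
        (hφ.hasCompactSupport_smul_const e)).toLp _) =
        ∫ x, inner ℝ (z.snd x) e * φ x := fun φ hφ e =>
    (hρ.inner_invWeight_smul (hφ.continuous_smul_const e) (hφ.hasCompactSupport_smul_const e)
      z.snd).trans (integral_congr_ae (Eventually.of_forall fun x =>
      (real_inner_smul_right _ _ _).trans (mul_comm _ _)))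
  constructor
  · intro h φ hφ e
    rw [e1 φ hφ e, e2 φ hφ e]
    exact h.integral_eq φ hφ e
  · intro h
    refine ⟨hρ.locallyIntegrable_Lp _, hρ.locallyIntegrable_Lp _, fun φ hφ e => ?_⟩
    rw [← e1 φ hφ e, ← e2 φ hφ e]
    exact h φ hφ e

lemma hasWeakGradient_sub {z z' : PairSpace ρ} (hz : HasWeakGradient z.fst z.snd)
    (hz' : HasWeakGradient z'.fst z'.snd) : HasWeakGradient (z - z').fst (z - z').snd := by
  rw [hρ.hasWeakGradient_iff] at hz hz' ⊢
  intro φ hφ e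
  rw [WithLp.sub_fst, WithLp.sub_snd, inner_sub_left, inner_sub_left, hz φ hφ e, hz' φ hφ e]
  ring

/-- Being a weak gradient is a closed condition on pairs of square integrable functions. -/
lemma isClosed_hasWeakGradient :
    IsClosed {z : PairSpace ρ | HasWeakGradient z.fst z.snd} := by
  have h1 : {z : PairSpace ρ | HasWeakGradient z.fst z.snd} =
      ⋂ (φ) (hφ : IsTestFunction φ) (e : Plane), {z : PairSpace ρ |
        inner ℝ z.fst ((hρ.memLp_invWeight_smul (hφ.continuous_fderiv e)
          (hφ.2.fderiv_apply (𝕜 := ℝ) e)).toLp _) =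
        -inner ℝ z.snd ((hρ.memLp_invWeight_smul (hφ.continuous_smul_const e)
        (hφ.hasCompactSupport_smul_const e)).toLp _)} := by
    ext z
    simp only [mem_iInter]
    exact hρ.hasWeakGradient_iff z
  rw [h1]
  have hfst : Continuous fun z : PairSpace ρ => z.fst := (WithLp.fstL 2 ℝ _ _).continuous
  have hsnd : Continuous fun z : PairSpace ρ => z.snd := (WithLp.sndL 2 ℝ _ _).continuous
  exact isClosed_iInter fun φ => isClosed_iInter fun hφ => isClosed_iInter fun e =>
    isClosed_eq (hfst.inner continuous_const) (hsnd.inner continuous_const).neg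

/-- The energy is the inner product of the gradient components, whichever representatives of the
weak gradients are chosen. -/
lemma energy_eq {z z' : PairSpace ρ} (hz : HasWeakGradient z.fst z.snd)
    (hz' : HasWeakGradient z'.fst z'.snd) :
    energy (weightedMeasure ρ) z.fst z'.fst = inner ℝ z.snd z'.snd := by
  rw [energy, L2.inner_def]
  refine integral_congr_ae ?_
  filter_upwards [hρ.ae_iff.2 hz.ae_eq_weakGradient, hρ.ae_iff.2 hz'.ae_eq_weakGradient]
    with x h1 h2
  rw [h1, h2]

end IsAdmissibleWeight

end WeakGradients

/-! ### The energy domain -/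

section EnergyDomain

lemma IsTestFunction.add {φ ψ : Plane → ℝ} (hφ : IsTestFunction φ) (hψ : IsTestFunction ψ) :
    IsTestFunction (φ + ψ) := ⟨hφ.1.add hψ.1, hφ.2.add hψ.2⟩

lemma IsTestFunction.const_smul {φ : Plane → ℝ} (hφ : IsTestFunction φ) (c : ℝ) :
    IsTestFunction (c • φ) :=
  ⟨contDiff_const.smul hφ.1, hφ.2.smul_left (f := fun _ => c)⟩

lemma IsTestFunction.gradient_add {φ ψ : Plane → ℝ} (hφ : IsTestFunction φ)
    (hψ : IsTestFunction ψ) : gradient (φ + ψ) = gradient φ + gradient ψ := by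
  funext x
  simp only [gradient, Pi.add_apply, fderiv_add (hφ.differentiable x) (hψ.differentiable x),
    map_add]

lemma IsTestFunction.gradient_const_smul {φ : Plane → ℝ} (hφ : IsTestFunction φ) (c : ℝ) :
    gradient (c • φ) = c • gradient φ := by
  funext x
  simp only [gradient, Pi.smul_apply, fderiv_const_smul (hφ.differentiable x), map_smulₛₗ,
    conj_trivial]

lemma isTestFunction_zero : IsTestFunction (0 : Plane → ℝ) :=
  ⟨contDiff_const, HasCompactSupport.zero⟩

/-- The pairs (test function, gradient). -/
def testPairs (ρ : Plane → ℝ≥0∞) : Submodule ℝ (PairSpace ρ) where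
  carrier := {z | ∃ φ, IsTestFunction φ ∧ z.fst =ᵐ[weightedMeasure ρ] φ ∧
    z.snd =ᵐ[weightedMeasure ρ] gradient φ}
  zero_mem' := by
    refine ⟨0, isTestFunction_zero, Lp.coeFn_zero _ _ _, ?_⟩
    have : gradient (0 : Plane → ℝ) = 0 := by
      have := isTestFunction_zero.gradient_const_smul 0
      simpa using this
    rw [this]
    exact Lp.coeFn_zero _ _ _
  add_mem' := by
    rintro z z' ⟨φ, hφ, h1, h2⟩ ⟨ψ, hψ, h3, h4⟩
    refine ⟨φ + ψ, hφ.add hψ, (Lp.coeFn_add _ _).trans (h1.add h3), ?_⟩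
    rw [hφ.gradient_add hψ]
    exact (Lp.coeFn_add _ _).trans (h2.add h4)
  smul_mem' := by
    rintro c z ⟨φ, hφ, h1, h2⟩
    refine ⟨c • φ, hφ.const_smul c, (Lp.coeFn_smul _ _).trans (h1.const_smul c), ?_⟩
    rw [hφ.gradient_const_smul]
    exact (Lp.coeFn_smul _ _).trans (h2.const_smul c)

/-- The Hilbert space of the form on `sobolevH`: the closure of the pairs
(test function, gradient). -/
abbrev energyDomain (ρ : Plane → ℝ≥0∞) : Submodule ℝ (PairSpace ρ) :=
  (testPairs ρ).topologicalClosure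

/-- The function component of an element of the energy domain. -/
def energyInclusion (ρ : Plane → ℝ≥0∞) : energyDomain ρ →L[ℝ] Lp ℝ 2 (weightedMeasure ρ) :=
  (WithLp.fstL 2 ℝ _ _).comp (energyDomain ρ).subtypeL

/-- The gradient component of an element of the energy domain. -/
def energyGradient (ρ : Plane → ℝ≥0∞) : energyDomain ρ →L[ℝ] Lp Plane 2 (weightedMeasure ρ) :=
  (WithLp.sndL 2 ℝ _ _).comp (energyDomain ρ).subtypeL

namespace IsAdmissibleWeight

variable {ρ : Plane → ℝ≥0∞} (hρ : IsAdmissibleWeight ρ)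
include hρ

lemma exists_testPair {φ : Plane → ℝ} (hφ : IsTestFunction φ) : ∃ z ∈ testPairs ρ,
    z.fst =ᵐ[weightedMeasure ρ] φ ∧ z.snd =ᵐ[weightedMeasure ρ] gradient φ := by
  have := hρ.isFiniteMeasureOnCompacts
  have h1 : MemLp φ 2 (weightedMeasure ρ) := hφ.continuous.memLp_of_hasCompactSupport hφ.2
  have h2 : MemLp (gradient φ) 2 (weightedMeasure ρ) :=
    hφ.continuous_gradient.memLp_of_hasCompactSupport hφ.hasCompactSupport_gradient
  exact ⟨WithLp.toLp 2 (h1.toLp φ, h2.toLp _), ⟨φ, hφ, h1.coeFn_toLp, h2.coeFn_toLp⟩,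
    h1.coeFn_toLp, h2.coeFn_toLp⟩

lemma hasWeakGradient_testPairs {z : PairSpace ρ} (hz : z ∈ testPairs ρ) :
    HasWeakGradient z.fst z.snd := by
  obtain ⟨φ, hφ, h1, h2⟩ := hz
  exact hφ.hasWeakGradient.congr (EventuallyEq.symm (hρ.ae_iff.1 h1))
    (EventuallyEq.symm (hρ.ae_iff.1 h2))

lemma hasWeakGradient_energyDomain {z : PairSpace ρ} (hz : z ∈ energyDomain ρ) :
    HasWeakGradient z.fst z.snd :=
  closure_minimal (fun _ h => hρ.hasWeakGradient_testPairs h) hρ.isClosed_hasWeakGradient hz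

omit hρ in
lemma fst_mem_sobolevW {z : PairSpace ρ} (hz : HasWeakGradient z.fst z.snd) :
    z.fst ∈ sobolevW (weightedMeasure ρ) := ⟨z.snd, hz, Lp.memLp _⟩

/-- The metric given by `E₁` is the metric of the Hilbert space of pairs. -/
lemma formShift_fst_sub {z z' : PairSpace ρ} (hz : HasWeakGradient z.fst z.snd)
    (hz' : HasWeakGradient z'.fst z'.snd) :
    formShift (energy (weightedMeasure ρ)) 1 (z.fst - z'.fst) (z.fst - z'.fst) =
      ‖z - z'‖ ^ 2 := by
  have h := hρ.hasWeakGradient_sub hz hz'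
  rw [← WithLp.sub_fst, formShift, hρ.energy_eq h h, WithLp.prod_norm_sq_eq_of_L2,
    real_inner_self_eq_norm_sq, real_inner_self_eq_norm_sq]
  ring

lemma sobolevH_eq_range : sobolevH (weightedMeasure ρ) = range (energyInclusion ρ) := by
  ext u
  constructor
  · rintro ⟨⟨g, hg, hg2⟩, happ⟩
    set z : PairSpace ρ := WithLp.toLp 2 (u, hg2.toLp g) with hz
    have hzw : HasWeakGradient z.fst z.snd :=
      hg.congr EventuallyEq.rfl (EventuallyEq.symm (hρ.ae_iff.1 hg2.coeFn_toLp))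
    refine ⟨⟨z, Metric.mem_closure_iff.2 fun ε hε => ?_⟩, rfl⟩
    obtain ⟨φ, hφ, w, -, hwφ, hlt⟩ := happ (ε ^ 2) (by positivity)
    obtain ⟨z', hz', h1, h2⟩ := hρ.exists_testPair hφ
    refine ⟨z', hz', ?_⟩
    have h3 : w = z'.fst := Lp.ext (hwφ.trans h1.symm)
    have h4 := hρ.formShift_fst_sub hzw (hρ.hasWeakGradient_testPairs hz')
    rw [← h3] at h4
    change formShift (energy (weightedMeasure ρ)) 1 (u - w) (u - w) = _ at h4
    rw [h4] at hlt
    rw [dist_eq_norm]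
    exact lt_of_pow_lt_pow_left₀ 2 hε.le hlt
  · rintro ⟨⟨z, hz⟩, rfl⟩
    have hzw := hρ.hasWeakGradient_energyDomain hz
    refine ⟨fst_mem_sobolevW hzw, fun ε hε => ?_⟩
    obtain ⟨z', hz', h1⟩ := Metric.mem_closure_iff.1 hz (√ε) (Real.sqrt_pos.2 hε)
    obtain ⟨φ, hφ, h2, h3⟩ := id hz'
    have hzw' := hρ.hasWeakGradient_testPairs hz'
    refine ⟨φ, hφ, z'.fst, fst_mem_sobolevW hzw', h2, ?_⟩
    refine (hρ.formShift_fst_sub hzw hzw').trans_lt ?_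
    rw [dist_eq_norm] at h1
    exact (Real.lt_sqrt (norm_nonneg _)).1 h1

/-- The form `(energy, sobolevH)` is represented by the energy domain. -/
lemma isFormOf : IsFormOf (energyInclusion ρ) (energyGradient ρ) (sobolevH (weightedMeasure ρ))
    (energy (weightedMeasure ρ)) where
  energySpace :=
    { inner_eq := fun p q => WithLp.prod_inner_apply _ _
      denseRange := by
        have := hρ.isFiniteMeasureOnCompacts
        refine (Lp.dense_hasCompactSupport_contDiff (F := ℝ) (μ := weightedMeasure ρ) (p := 2)
          (by simp)).mono ?_
        rintro f ⟨φ, hfφ, hc, hs⟩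
        obtain ⟨z, hz, h1, -⟩ := hρ.exists_testPair (φ := φ) ⟨hs, hc⟩
        refine ⟨⟨z, (testPairs ρ).le_topologicalClosure hz⟩, ?_⟩
        exact Lp.ext (h1.trans hfφ.symm) }
  domain := hρ.sobolevH_eq_range
  form p q := hρ.energy_eq (hρ.hasWeakGradient_energyDomain p.2)
    (hρ.hasWeakGradient_energyDomain q.2)

lemma exists_energyInclusion_eq {φ : Plane → ℝ} (hφ : IsTestFunction φ) : ∃ p : energyDomain ρ,
    energyInclusion ρ p =ᵐ[weightedMeasure ρ] φ ∧
    energyGradient ρ p =ᵐ[weightedMeasure ρ] gradient φ := by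
  obtain ⟨z, hz, h1, h2⟩ := hρ.exists_testPair hφ
  exact ⟨⟨z, (testPairs ρ).le_topologicalClosure hz⟩, h1, h2⟩

/-! ### Regularity and strong locality -/

/-- The test functions form a core. -/
theorem isRegularForm :
    IsRegularForm (sobolevH (weightedMeasure ρ)) (energy (weightedMeasure ρ)) := by
  have hF := hρ.isFormOf
  refine ⟨{φ | IsTestFunction φ}, fun φ hφ => ?_, fun u hu ε hε => ?_, fun f ε hε => ?_⟩
  · obtain ⟨p, hp, -⟩ := hρ.exists_energyInclusion_eq hφ
    exact ⟨_, hF.mem p, hp⟩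
  · obtain ⟨φ, hφ, w, -, hwφ, hlt⟩ := hu.2 ε hε
    obtain ⟨p, hp, -⟩ := hρ.exists_energyInclusion_eq hφ
    refine ⟨⟨⟨φ, hφ.continuous⟩, hφ.2⟩, hφ, w, ?_, hwφ, hlt⟩
    rw [show w = energyInclusion ρ p from Lp.ext (hwφ.trans hp.symm)]
    exact hF.mem p
  · obtain ⟨g, hg, hfg, hsupp⟩ := (map_continuous f).exists_contDiff_approx ⊤
      (ε := fun _ => ε) continuous_const (fun _ => hε)
    have hgc : HasCompactSupport g := f.hasCompactSupport.mono hsupp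
    refine ⟨⟨⟨g, hg.continuous⟩, hgc⟩, ⟨hg, hgc⟩, fun x => ?_⟩
    have := hfg x
    rw [dist_comm, Real.dist_eq] at this
    exact this

lemma ae_eq_zero_of_notMem_L2supp (u : Lp ℝ 2 (weightedMeasure ρ)) :
    ∀ᵐ x, x ∈ (L2supp u)ᶜ → u x = 0 := by
  have h1 : (weightedMeasure ρ).withDensity (fun x => ‖u x‖ₑ) (L2supp u)ᶜ = 0 :=
    Measure.measure_compl_support
  have hm : MeasurableSet (L2supp u)ᶜ := Measure.isClosed_support.measurableSet.compl
  rw [withDensity_apply _ hm,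
    lintegral_eq_zero_iff' (Lp.aestronglyMeasurable u).enorm.restrict] at h1
  rw [← hρ.ae_iff]
  filter_upwards [(ae_restrict_iff' hm).1 h1] with x hx hxu
  simpa using hx hxu

theorem isStronglyLocalForm :
    IsStronglyLocalForm (sobolevH (weightedMeasure ρ)) (energy (weightedMeasure ρ)) := by
  intro u hu v hv _ _ hU
  obtain ⟨U, hUo, hsU, c, hc⟩ := hU
  have hF := hρ.isFormOf
  obtain ⟨p, rfl⟩ := hF.exists_eq hu
  obtain ⟨q, rfl⟩ := hF.exists_eq hv
  have h1 := (hρ.hasWeakGradient_energyDomain p.2).ae_eq_zero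
    Measure.isClosed_support.isOpen_compl (hρ.ae_eq_zero_of_notMem_L2supp (energyInclusion ρ p))
  have h2 := (hρ.hasWeakGradient_energyDomain q.2).ae_eq_zero hUo (hρ.ae_iff.1 hc)
  rw [hF.form, L2.inner_def]
  refine integral_eq_zero_of_ae (hρ.ae_iff.2 ?_)
  filter_upwards [h1, h2] with x h3 h4
  by_cases hx : x ∈ L2supp (energyInclusion ρ p)
  · have : energyGradient ρ q x = 0 := h4 (hsU hx)
    rw [this, inner_zero_right]; rfl
  · have : energyGradient ρ p x = 0 := h3 hx
    rw [this, inner_zero_left]; rfl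

end IsAdmissibleWeight

end EnergyDomain

/-! ### The Markov property -/

section Markov

/-- Smooth functions approximating the unit contraction `(0 ∨ t) ∧ 1` uniformly, whose slopes do
not exceed `1`. -/
lemma exists_smooth_unitContraction {δ : ℝ} (hδ : 0 < δ) : ∃ F : ℝ → ℝ, ContDiff ℝ (⊤ : ℕ∞) F ∧
    F 0 = 0 ∧ (∀ t, |deriv F t| ≤ 1) ∧ ∀ t, |F t - min (max 0 t) 1| ≤ δ := by
  -- the primitive of a bump function which is `1` on most of `(0, 1)` and vanishes off `(0, 1)`
  set η : ℝ := min (δ / 2) (1 / 4) with hη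
  have hη0 : 0 < η := by positivity
  have hη1 : η ≤ 1 / 4 := min_le_right _ _
  have hη2 : 2 * η ≤ δ := by linarith [min_le_left (δ / 2) (1 / 4)]
  let b : ContDiffBump (1 / 2 : ℝ) := ⟨1 / 2 - η, 1 / 2, by linarith, by linarith⟩
  have hbc : Continuous b := b.continuous
  have hint : ∀ s t, IntervalIntegrable b volume s t := fun s t => hbc.intervalIntegrable s t
  have hb0 : ∀ t, t ∉ Ioo (0 : ℝ) 1 → b t = 0 := by
    intro t ht
    refine b.zero_of_le_dist ?_
    by_contra! h
    rw [Real.dist_eq, abs_lt] at h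
    change -(1 / 2) < _ ∧ _ < 1 / 2 at h
    exact ht ⟨by linarith [h.1], by linarith [h.2]⟩
  set F : ℝ → ℝ := fun t => ∫ s in (0 : ℝ)..t, b s with hF
  have hderiv : ∀ t, HasDerivAt F (b t) t := fun t =>
    intervalIntegral.integral_hasDerivAt_right (hint _ _)
      hbc.stronglyMeasurable.stronglyMeasurableAtFilter hbc.continuousAt
  have hd : deriv F = b := funext fun t => (hderiv t).deriv
  have hadd : ∀ s t, F t = F s + ∫ x in s..t, b x := fun s t =>
    (intervalIntegral.integral_add_adjacent_intervals (hint _ _) (hint _ _)).symm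
  have hconst : ∀ s t, Disjoint (uIoc s t) (Ioo 0 1) → F t = F s := by
    intro s t hst
    rw [hadd s t, intervalIntegral.integral_congr_ae (g := fun _ => (0 : ℝ))
      (Eventually.of_forall fun x hx => hb0 x (hst.notMem_of_mem_left hx))]
    simp
  have hF0 : F 0 = 0 := intervalIntegral.integral_same
  have hup : ∀ s t, s ≤ t → F t ≤ F s + (t - s) := by
    intro s t hst
    rw [hadd s t]
    have := intervalIntegral.integral_mono_on hst (hint s t)
      (continuous_const (y := (1 : ℝ)).intervalIntegrable _ _) fun x _ => b.le_one
    simpa using this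
  have hmono : ∀ s t, s ≤ t → F s ≤ F t := by
    intro s t hst
    rw [hadd s t]
    linarith [intervalIntegral.integral_nonneg hst (μ := volume) fun x _ => b.nonneg (x := x)]
  have hmid : F (1 - η) = F η + (1 - 2 * η) := by
    rw [hadd η (1 - η), intervalIntegral.integral_congr (g := fun _ => (1 : ℝ))]
    · simp; ring
    · intro x hx
      rw [uIcc_of_le (by linarith)] at hx
      refine b.one_of_mem_closedBall ?_
      rw [Metric.mem_closedBall, Real.dist_eq, abs_le]
      change -(1 / 2 - η) ≤ _ ∧ _ ≤ 1 / 2 - η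
      exact ⟨by linarith [hx.1], by linarith [hx.2]⟩
  have h1 : 1 - 2 * η ≤ F 1 := by
    have h2 := hmono 0 η hη0.le
    have h3 := hmono (1 - η) 1 (by linarith)
    linarith
  have h1' : F 1 ≤ 1 := by linarith [hup 0 1 zero_le_one]
  refine ⟨F, contDiff_infty_iff_deriv.2 ⟨fun t => (hderiv t).differentiableAt, ?_⟩, hF0,
    fun t => ?_, fun t => ?_⟩
  · rw [hd]; exact b.contDiff
  · rw [hd, abs_of_nonneg b.nonneg]; exact b.le_one
  · rw [abs_le]
    rcases le_total t 0 with ht | ht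
    · rw [max_eq_left ht, min_eq_left zero_le_one, hconst 0 t, hF0]
      · constructor <;> linarith
      · rw [uIoc_of_ge ht, Set.disjoint_left]
        exact fun x hx hx' => hx.2.not_gt hx'.1
    rw [max_eq_right ht]
    rcases le_total t 1 with ht1 | ht1
    · rw [min_eq_left ht1]
      have h2 := hup 0 t ht
      have h3 := hup t 1 ht1
      constructor <;> linarith
    · rw [min_eq_right ht1, hconst 1 t]
      · constructor <;> linarith
      · rw [uIoc_of_le ht1, Set.disjoint_left]
        exact fun x hx hx' => hx.1.not_gt hx'.2

lemma lipschitzWith_unitContraction : LipschitzWith 1 fun t : ℝ => min (max 0 t) 1 :=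
  (LipschitzWith.id.const_max 0).min_const 1

lemma IsTestFunction.comp {φ : Plane → ℝ} (hφ : IsTestFunction φ) {F : ℝ → ℝ}
    (hF : ContDiff ℝ (⊤ : ℕ∞) F) (hF0 : F 0 = 0) : IsTestFunction (F ∘ φ) :=
  ⟨hF.comp hφ.1, hφ.2.comp_left hF0⟩

lemma IsTestFunction.gradient_comp {φ : Plane → ℝ} (hφ : IsTestFunction φ) {F : ℝ → ℝ}
    (hF : ContDiff ℝ (⊤ : ℕ∞) F) (x : Plane) :
    gradient (F ∘ φ) x = deriv F (φ x) • gradient φ x := by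
  have h1 : HasDerivAt F (deriv F (φ x)) (φ x) :=
    (hF.differentiable (by simp) _).hasDerivAt
  have h2 := h1.comp_hasFDerivAt x (hφ.differentiable x).hasFDerivAt
  rw [gradient, h2.fderiv, map_smulₛₗ, conj_trivial, gradient]

variable {ρ : Plane → ℝ≥0∞} (hρ : IsAdmissibleWeight ρ)
include hρ

/-- The truncation of a test function is approximated in `L²` by test functions with smaller
gradients. -/
lemma IsAdmissibleWeight.exists_truncation {z : PairSpace ρ} (hz : z ∈ testPairs ρ) {ε : ℝ}
    (hε : 0 < ε) : ∃ p : energyDomain ρ, ‖energyGradient ρ p‖ ≤ ‖z.snd‖ ∧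
      ‖energyInclusion ρ p - lipschitzWith_unitContraction.compLp (by simp) z.fst‖ ≤ ε := by
  have := hρ.isFiniteMeasureOnCompacts
  obtain ⟨φ, hφ, h1, h2⟩ := hz
  set m : ℝ := ((weightedMeasure ρ (tsupport φ)) ^ (1 / (2 : ℝ≥0∞).toReal)).toReal with hm
  have hmtop : (weightedMeasure ρ (tsupport φ)) ^ (1 / (2 : ℝ≥0∞).toReal) ≠ ∞ :=
    ENNReal.rpow_ne_top_of_nonneg (by simp) (hφ.2.isCompact.measure_lt_top).ne
  have hm0 : 0 ≤ m := ENNReal.toReal_nonneg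
  obtain ⟨F, hF, hF0, hF1, hFδ⟩ := exists_smooth_unitContraction (δ := ε / (m + 1)) (by positivity)
  obtain ⟨p, hp1, hp2⟩ := hρ.exists_energyInclusion_eq (hφ.comp hF hF0)
  refine ⟨p, Lp.norm_le_norm_of_ae_le ?_, ?_⟩
  · filter_upwards [h2, hp2] with x hx hpx
    rw [hpx, hx, hφ.gradient_comp hF, norm_smul]
    exact mul_le_of_le_one_left (norm_nonneg _) (hF1 _)
  · have h3 : eLpNorm (F ∘ φ - (fun t : ℝ => min (max 0 t) 1) ∘ φ) 2 (weightedMeasure ρ) ≤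
        ENNReal.ofReal (ε / (m + 1)) *
          weightedMeasure ρ (tsupport φ) ^ (1 / (2 : ℝ≥0∞).toReal) := by
      refine eLpNorm_sub_le_of_dist_bdd (weightedMeasure ρ) (by simp)
        (isClosed_tsupport φ).measurableSet (by positivity) (fun x => hFδ (φ x)) ?_ ?_
      · refine (Function.support_comp_subset hF0 φ).trans (subset_tsupport φ)
      · exact (Function.support_comp_subset (by simp) φ).trans (subset_tsupport φ)
    have h4 : ((energyInclusion ρ p - lipschitzWith_unitContraction.compLp (by simp) z.fst :
        Lp ℝ 2 (weightedMeasure ρ)) : Plane → ℝ) =ᵐ[weightedMeasure ρ]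
        F ∘ φ - (fun t : ℝ => min (max 0 t) 1) ∘ φ := by
      filter_upwards [Lp.coeFn_sub (energyInclusion ρ p)
        (lipschitzWith_unitContraction.compLp (by simp) z.fst),
        lipschitzWith_unitContraction.coeFn_compLp (by simp) z.fst, hp1, h1] with x h5 h6 h7 h8
      rw [h5, Pi.sub_apply, h6, h7, Pi.sub_apply]
      simp only [Function.comp_apply, h8]
    rw [Lp.norm_def, eLpNorm_congr_ae h4]
    refine ENNReal.toReal_le_of_le_ofReal hε.le (h3.trans ?_)
    rw [← ENNReal.ofReal_toReal hmtop, ← hm, ← ENNReal.ofReal_mul (by positivity)]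
    refine ENNReal.ofReal_le_ofReal ?_
    rw [div_mul_eq_mul_div, div_le_iff₀ (by positivity)]
    nlinarith

/-- The unit contraction operates: the truncations of approximating test functions converge in `L²`
and their energies are bounded by energies converging to that of `u`. -/
theorem IsAdmissibleWeight.isMarkovianForm :
    IsMarkovianForm (sobolevH (weightedMeasure ρ)) (energy (weightedMeasure ρ)) := by
  intro u hu
  have hF := hρ.isFormOf
  obtain ⟨⟨z, hz⟩, rfl⟩ := hF.exists_eq hu
  obtain ⟨y, hy, hyz⟩ := mem_closure_iff_seq_limit.1 hz
  choose p hp1 hp2 using fun n : ℕ =>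
    hρ.exists_truncation (hy n) (ε := 1 / ((n : ℝ) + 1)) (by positivity)
  have hfst : Tendsto (fun n => (y n).fst) atTop (𝓝 z.fst) :=
    ((WithLp.fstL 2 ℝ _ _).continuous.tendsto z).comp hyz
  have hsnd : Tendsto (fun n => ‖(y n).snd‖) atTop (𝓝 ‖z.snd‖) :=
    (((WithLp.sndL 2 ℝ _ _).continuous.tendsto z).comp hyz).norm
  have hτ : Tendsto (fun n => lipschitzWith_unitContraction.compLp (by simp) (y n).fst) atTop
      (𝓝 (lipschitzWith_unitContraction.compLp (by simp) z.fst)) :=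
    ((lipschitzWith_unitContraction.continuous_compLp (by simp)).tendsto _).comp hfst
  have hlim : Tendsto (fun n => energyInclusion ρ (p n)) atTop
      (𝓝 (lipschitzWith_unitContraction.compLp (by simp) z.fst)) := by
    have h0 := squeeze_zero_norm hp2 tendsto_one_div_add_atTop_nhds_zero_nat
    simpa using! h0.add hτ
  obtain ⟨q, hq1, hq2⟩ := hF.energySpace.exists_of_tendsto hlim hp1 hsnd
  refine ⟨energyInclusion ρ q, hF.mem q, ?_, ?_⟩
  · rw [hq1]
    exact lipschitzWith_unitContraction.coeFn_compLp (by simp) z.fst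
  · rw [hF.form, hF.form, real_inner_self_eq_norm_sq, real_inner_self_eq_norm_sq]
    exact pow_le_pow_left₀ (norm_nonneg _) hq2 2

end Markov

/-! ### Logarithmic cutoff functions -/

section LogCutoff

/-- A smooth function which is `1` on `(-∞, 1]` and `0` on `[2, ∞)`. -/
def smoothStep (t : ℝ) : ℝ := Real.smoothTransition (2 - t)

lemma contDiff_smoothStep : ContDiff ℝ (⊤ : ℕ∞) smoothStep :=
  Real.smoothTransition.contDiff.comp (contDiff_const.sub contDiff_id)

lemma smoothStep_eq_one {t : ℝ} (ht : t ≤ 1) : smoothStep t = 1 :=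
  Real.smoothTransition.one_of_one_le (by linarith)

lemma smoothStep_eq_zero {t : ℝ} (ht : 2 ≤ t) : smoothStep t = 0 :=
  Real.smoothTransition.zero_of_nonpos (by linarith)

lemma deriv_smoothStep_eq_zero {t : ℝ} (ht : t ∉ Icc (1 : ℝ) 2) : deriv smoothStep t = 0 := by
  rw [mem_Icc, not_and_or, not_le, not_le] at ht
  rcases ht with ht | ht
  · have : smoothStep =ᶠ[𝓝 t] fun _ => 1 := by
      filter_upwards [Iio_mem_nhds ht] with s hs using smoothStep_eq_one (le_of_lt hs)
    rw [this.deriv_eq, deriv_const]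
  · have : smoothStep =ᶠ[𝓝 t] fun _ => 0 := by
      filter_upwards [Ioi_mem_nhds ht] with s hs using smoothStep_eq_zero (le_of_lt hs)
    rw [this.deriv_eq, deriv_const]

lemma exists_deriv_smoothStep_le : ∃ C : ℝ, ∀ t, |deriv smoothStep t| ≤ C := by
  obtain ⟨C, hC⟩ := isCompact_Icc.exists_bound_of_continuousOn (s := Icc (1 : ℝ) 2)
    (contDiff_smoothStep.continuous_deriv (by simp)).continuousOn
  refine ⟨C, fun t => ?_⟩
  by_cases ht : t ∈ Icc (1 : ℝ) 2
  · exact hC t ht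
  · rw [deriv_smoothStep_eq_zero ht, abs_zero]
    exact (norm_nonneg _).trans (hC 1 ⟨le_rfl, one_le_two⟩)

/-- The cutoff function which decreases from `1` to `0`, linearly in `log |x|` up to smoothing,
as `1 + |x|²` runs from `e ^ s` to `e ^ (2s)`. -/
def logCutoff (s : ℝ) (x : Plane) : ℝ := smoothStep (Real.log (1 + ‖x‖ ^ 2) / s)

lemma logCutoff_mem_Icc (s : ℝ) (x : Plane) : logCutoff s x ∈ Icc (0 : ℝ) 1 :=
  ⟨Real.smoothTransition.nonneg _, Real.smoothTransition.le_one _⟩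

lemma logCutoff_eq_one {s : ℝ} (hs : 0 < s) {x : Plane} (hx : Real.log (1 + ‖x‖ ^ 2) ≤ s) :
    logCutoff s x = 1 :=
  smoothStep_eq_one ((div_le_one hs).2 hx)

lemma two_mul_lt_log {s : ℝ} {x : Plane} (hx : Real.exp s < ‖x‖) :
    2 * s < Real.log (1 + ‖x‖ ^ 2) := by
  rw [Real.lt_log_iff_exp_lt (by positivity), two_mul, Real.exp_add]
  nlinarith [Real.exp_pos s]

lemma isTestFunction_logCutoff {s : ℝ} (hs : 0 < s) : IsTestFunction (logCutoff s) := by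
  refine ⟨contDiff_smoothStep.comp (((contDiff_const.add (contDiff_norm_sq ℝ)).log
    fun x => by positivity).div_const s), ?_⟩
  refine HasCompactSupport.intro (isCompact_closedBall (0 : Plane) (Real.exp s)) fun x hx => ?_
  rw [mem_closedBall_zero_iff, not_le] at hx
  exact smoothStep_eq_zero ((le_div_iff₀ hs).2 (two_mul_lt_log hx).le)

lemma norm_gradient_logCutoff {s : ℝ} (hs : 0 < s) (x : Plane) :
    ‖gradient (logCutoff s) x‖ = |deriv smoothStep (Real.log (1 + ‖x‖ ^ 2) / s)| *
      (2 * ‖x‖ / (1 + ‖x‖ ^ 2) / s) := by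
  have h1 : HasDerivAt smoothStep _ (Real.log (1 + ‖x‖ ^ 2) / s) :=
    (contDiff_smoothStep.differentiable (by simp) _).hasDerivAt
  have h2 : HasFDerivAt (fun x : Plane => Real.log (1 + ‖x‖ ^ 2)) _ x :=
    ((hasStrictFDerivAt_norm_sq x).hasFDerivAt.const_add 1).log (by positivity)
  have h3 := h1.comp_hasFDerivAt x (h2.mul_const s⁻¹)
  have h4 : fderiv ℝ (logCutoff s) x = _ := h3.fderiv
  have h5 : ‖2 • innerSL ℝ x‖ = 2 * ‖x‖ := by
    rw [← Nat.cast_smul_eq_nsmul ℝ, norm_smul, innerSL_apply_norm]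
    simp
  rw [gradient, LinearIsometryEquiv.norm_map, h4]
  simp only [norm_smul, h5, Real.norm_eq_abs, abs_inv, abs_of_pos hs,
    abs_of_pos (show 0 < 1 + ‖x‖ ^ 2 by positivity)]
  ring

lemma gradient_logCutoff_eq_zero {s : ℝ} (hs : 1 ≤ s) {x : Plane} (hx : ‖x‖ < 1) :
    gradient (logCutoff s) x = 0 := by
  rw [← norm_eq_zero, norm_gradient_logCutoff (by linarith), deriv_smoothStep_eq_zero, abs_zero,
    zero_mul]
  rintro ⟨h1, -⟩
  rw [le_div_iff₀ (by linarith), one_mul] at h1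
  have h2 : Real.log (1 + ‖x‖ ^ 2) ≤ Real.log 2 :=
    Real.log_le_log (by positivity) (by nlinarith [norm_nonneg x])
  linarith [Real.log_two_lt_d9]

/-- The bound comes from `|∇ log (1 + |x|²)|² ≤ 4 / (1 + |x|²)`. -/
lemma norm_gradient_logCutoff_sq_le {C : ℝ} (hC : ∀ t, |deriv smoothStep t| ≤ C) {s : ℝ}
    (hs : 0 < s) (x : Plane) : ‖gradient (logCutoff s) x‖ ^ 2 ≤
      4 * C ^ 2 / s ^ 2 * (Iic (Real.exp s)).indicator (fun r => (1 + r ^ 2)⁻¹) ‖x‖ := by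
  rw [norm_gradient_logCutoff hs]
  by_cases hx : ‖x‖ ∈ Iic (Real.exp s)
  · rw [indicator_of_mem hx, mul_pow]
    have h1 : (2 * ‖x‖ / (1 + ‖x‖ ^ 2) / s) ^ 2 ≤ 4 / s ^ 2 * (1 + ‖x‖ ^ 2)⁻¹ := by
      have h2 : (‖x‖ / (1 + ‖x‖ ^ 2)) ^ 2 ≤ (1 + ‖x‖ ^ 2)⁻¹ := by
        rw [div_pow, div_le_iff₀ (by positivity), sq (1 + ‖x‖ ^ 2),
          inv_mul_cancel_left₀ (by positivity)]
        linarith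
      calc (2 * ‖x‖ / (1 + ‖x‖ ^ 2) / s) ^ 2 = 4 / s ^ 2 * (‖x‖ / (1 + ‖x‖ ^ 2)) ^ 2 := by ring
        _ ≤ _ := by gcongr
    calc _ ≤ C ^ 2 * (4 / s ^ 2 * (1 + ‖x‖ ^ 2)⁻¹) :=
          mul_le_mul (pow_le_pow_left₀ (abs_nonneg _) (hC _) 2) h1 (by positivity) (by positivity)
      _ = _ := by ring
  · rw [indicator_of_notMem hx, mul_zero, deriv_smoothStep_eq_zero]
    · simp
    · rintro ⟨-, h1⟩
      rw [div_le_iff₀ hs] at h1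
      linarith [two_mul_lt_log (not_le.1 hx)]

lemma hasDerivAt_half_log (r : ℝ) :
    HasDerivAt (fun r : ℝ => Real.log (1 + r ^ 2) / 2) (r * (1 + r ^ 2)⁻¹) r := by
  have h1 : HasDerivAt (fun r : ℝ => 1 + r ^ 2) (2 * r) r := by
    simpa using (hasDerivAt_pow 2 r).const_add 1
  refine ((h1.log (by positivity)).div_const 2).congr_deriv ?_
  ring

/-- The radial integral `∫ r / (1 + r²) dr` up to `e^s` grows only linearly in `s`; this logarithmic
growth is what makes the plane recurrent. -/
lemma integral_mul_indicator_inv {s : ℝ} (hs : 1 ≤ s) :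
    IntegrableOn (fun r => r * (Iic (Real.exp s)).indicator (fun r => (1 + r ^ 2)⁻¹) r) (Ioi 0) ∧
    ∫ r in Ioi (0 : ℝ), r * (Iic (Real.exp s)).indicator (fun r => (1 + r ^ 2)⁻¹) r ≤ 2 * s := by
  have h0 : (fun r : ℝ => r * (Iic (Real.exp s)).indicator (fun r => (1 + r ^ 2)⁻¹) r) =
      (Iic (Real.exp s)).indicator fun r => r * (1 + r ^ 2)⁻¹ := by
    ext r
    by_cases hr : r ∈ Iic (Real.exp s) <;> simp only [hr, indicator_of_mem, not_false_eq_true,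
      indicator_of_notMem, mul_zero]
  have hc : Continuous fun r : ℝ => r * (1 + r ^ 2)⁻¹ :=
    continuous_id.mul
      ((by fun_prop : Continuous fun r : ℝ => 1 + r ^ 2).inv₀ fun r => by positivity)
  have he : 0 ≤ Real.exp s := (Real.exp_pos s).le
  rw [h0]
  constructor
  · rw [IntegrableOn, integrable_indicator_iff measurableSet_Iic, IntegrableOn,
      Measure.restrict_restrict measurableSet_Iic, inter_comm, Ioi_inter_Iic]
    exact (hc.intervalIntegrable 0 (Real.exp s)).1
  · rw [setIntegral_indicator measurableSet_Iic, Ioi_inter_Iic,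
      ← intervalIntegral.integral_of_le he,
      intervalIntegral.integral_eq_sub_of_hasDerivAt (fun r _ => hasDerivAt_half_log r)
        (hc.intervalIntegrable _ _)]
    have h1 : Real.log (1 + Real.exp s ^ 2) ≤ 4 * s := by
      rw [Real.log_le_iff_le_exp (by positivity), show 4 * s = s + s + (s + s) by ring,
        Real.exp_add, Real.exp_add]
      have := Real.add_one_le_exp s
      nlinarith [mul_le_mul (show (2 : ℝ) ≤ Real.exp s by linarith)
        (show (2 : ℝ) ≤ Real.exp s by linarith) (by norm_num) he]
    simp only [ne_eq, OfNat.ofNat_ne_zero, not_false_eq_true, zero_pow, add_zero, Real.log_one,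
      zero_div, sub_zero]
    linarith

lemma integrable_indicator_inv_norm {s : ℝ} (hs : 1 ≤ s) :
    Integrable (fun x : Plane => (Iic (Real.exp s)).indicator (fun r => (1 + r ^ 2)⁻¹) ‖x‖) := by
  rw [integrable_fun_norm_addHaar (volume : Measure Plane)
    (f := (Iic (Real.exp s)).indicator fun r => (1 + r ^ 2)⁻¹)]
  simpa using (integral_mul_indicator_inv hs).1

lemma integral_indicator_inv_norm_le {s : ℝ} (hs : 1 ≤ s) :
    ∫ x : Plane, (Iic (Real.exp s)).indicator (fun r => (1 + r ^ 2)⁻¹) ‖x‖ ≤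
      4 * s * (volume : Measure Plane).real (Metric.ball 0 1) := by
  rw [integral_fun_norm_addHaar (volume : Measure Plane)
    ((Iic (Real.exp s)).indicator fun r => (1 + r ^ 2)⁻¹)]
  have h1 := (integral_mul_indicator_inv hs).2
  simp only [finrank_euclideanSpace, Fintype.card_fin, Nat.add_one_sub_one, pow_one, smul_eq_mul,
    nsmul_eq_mul, Nat.cast_ofNat]
  have := mul_le_mul_of_nonneg_left h1
    (measureReal_nonneg (μ := (volume : Measure Plane)) (s := Metric.ball 0 1))
  linarith

variable {ρ : Plane → ℝ≥0∞} (hρ : IsAdmissibleWeight ρ)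
include hρ

lemma IsAdmissibleWeight.integral_norm_gradient_logCutoff_le (h1 : ∀ x, 1 ≤ ‖x‖ → ρ x ≤ 1)
    {C : ℝ} (hC : ∀ t, |deriv smoothStep t| ≤ C) {s : ℝ} (hs : 1 ≤ s) :
    ∫ x, ‖gradient (logCutoff s) x‖ ^ 2 ∂weightedMeasure ρ ≤
      16 * C ^ 2 * (volume : Measure Plane).real (Metric.ball 0 1) / s := by
  have hs0 : 0 < s := by linarith
  rw [integral_withDensity_eq_integral_toReal_smul hρ.measurable
    (Eventually.of_forall fun x => (hρ.ne_top x).lt_top)]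
  calc ∫ x, (ρ x).toReal • ‖gradient (logCutoff s) x‖ ^ 2
      ≤ ∫ x : Plane, 4 * C ^ 2 / s ^ 2 *
          (Iic (Real.exp s)).indicator (fun r => (1 + r ^ 2)⁻¹) ‖x‖ := by
        refine integral_mono_of_nonneg (Eventually.of_forall fun x => ?_)
          ((integrable_indicator_inv_norm hs).const_mul _) (Eventually.of_forall fun x => ?_)
        · exact smul_nonneg ENNReal.toReal_nonneg (sq_nonneg _)
        · refine le_trans ?_ (norm_gradient_logCutoff_sq_le hC hs0 x)
          -- the gradient vanishes where the weight is not known to be bounded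
          rcases lt_or_ge ‖x‖ 1 with hx | hx
          · simp [gradient_logCutoff_eq_zero hs hx]
          · exact mul_le_of_le_one_left (sq_nonneg _)
              (ENNReal.toReal_le_of_le_ofReal zero_le_one (by simpa using h1 x hx))
    _ ≤ 4 * C ^ 2 / s ^ 2 * (4 * s * (volume : Measure Plane).real (Metric.ball 0 1)) := by
        rw [integral_const_mul]
        gcongr
        exact integral_indicator_inv_norm_le hs
    _ = _ := by field_simp; ring

/-- For a weight which is bounded by `1` off the unit disc, the logarithmic cutoff functions
approximate the constant `1`: their energy is of order `1 / s`. -/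
theorem IsAdmissibleWeight.exists_isUnitApproximation (h1 : ∀ x, 1 ≤ ‖x‖ → ρ x ≤ 1) :
    ∃ u, IsUnitApproximation (sobolevH (weightedMeasure ρ)) (energy (weightedMeasure ρ)) u := by
  have hF := hρ.isFormOf
  have hpos : ∀ n : ℕ, (0 : ℝ) < n + 1 := fun n => by positivity
  choose p hp1 hp2 using fun n : ℕ =>
    hρ.exists_energyInclusion_eq (isTestFunction_logCutoff (hpos n))
  obtain ⟨C, hC⟩ := exists_deriv_smoothStep_le
  refine ⟨fun n => energyInclusion ρ (p n), fun n => hF.mem _, fun n => ?_, fun K hK => ?_, ?_⟩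
  · filter_upwards [hp1 n] with x hx
    rw [hx]
    exact logCutoff_mem_Icc _ _
  · obtain ⟨R, hR⟩ := hK.isBounded.exists_norm_le
    filter_upwards [eventually_ge_atTop ⌈Real.log (1 + R ^ 2)⌉₊] with n hn
    filter_upwards [hp1 n] with x hx hxK
    rw [hx]
    refine logCutoff_eq_one (hpos n) ?_
    have h2 : Real.log (1 + ‖x‖ ^ 2) ≤ Real.log (1 + R ^ 2) := by
      have := hR x hxK
      gcongr
    linarith [Nat.ceil_le.1 hn]
  · have hlim : Tendsto (fun n : ℕ => 16 * C ^ 2 *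
        (volume : Measure Plane).real (Metric.ball 0 1) / ((n : ℝ) + 1)) atTop (𝓝 0) :=
      tendsto_const_nhds.div_atTop (tendsto_natCast_atTop_atTop.atTop_add tendsto_const_nhds)
    refine squeeze_zero (fun n => ?_) (fun n => ?_) hlim
    · rw [hF.form]
      exact real_inner_self_nonneg
    · rw [hF.form, L2.inner_def]
      refine le_trans (le_of_eq (integral_congr_ae ?_))
        (hρ.integral_norm_gradient_logCutoff_le h1 hC (s := n + 1) (by simp))
      filter_upwards [hp2 n] with x hx
      rw [hx, real_inner_self_eq_norm_sq]

end LogCutoff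

/-! ### The radial weight -/

section Weight

/-- Radial functions on the unit disc, integrated in polar coordinates. -/
lemma integrable_indicator_toReal_norm {f : ℝ → ℝ≥0∞} (hf : Measurable f)
    (hfin : ∫⁻ r in Ioc (0 : ℝ) 1, ENNReal.ofReal r * f r < ∞) :
    Integrable (fun x : Plane => (Ioc (0 : ℝ) 1).indicator (fun r => (f r).toReal) ‖x‖) := by
  rw [integrable_fun_norm_addHaar (volume : Measure Plane)
    (f := (Ioc (0 : ℝ) 1).indicator fun r => (f r).toReal)]
  have h0 : (fun r : ℝ => r ^ (Module.finrank ℝ Plane - 1) •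
      (Ioc (0 : ℝ) 1).indicator (fun r => (f r).toReal) r) =
      (Ioc (0 : ℝ) 1).indicator fun r => r * (f r).toReal := by
    ext r
    by_cases hr : r ∈ Ioc (0 : ℝ) 1 <;> simp [hr]
  rw [h0]
  refine Integrable.integrableOn ((integrable_indicator_iff measurableSet_Ioc).2
    ⟨(measurable_id.mul hf.ennreal_toReal).aestronglyMeasurable, ?_⟩)
  rw [hasFiniteIntegral_iff_enorm]
  refine lt_of_le_of_lt (setLIntegral_mono' measurableSet_Ioc fun r hr => ?_) hfin
  rw [enorm_mul, Real.enorm_eq_ofReal hr.1.le, Real.enorm_eq_ofReal ENNReal.toReal_nonneg]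
  gcongr
  exact ENNReal.ofReal_toReal_le

namespace IsZhikovProfile

variable {a : ℝ → ℝ≥0∞} (ha : IsZhikovProfile a)
include ha

lemma ne_zero {r : ℝ} (hr : r ∈ Ioc (0 : ℝ) 1) : a r ≠ 0 := by
  obtain ⟨c, hc, h⟩ := ha.nondegenerate (r / 2) (half_pos hr.1)
  exact ((ENNReal.ofReal_pos.2 hc).trans_le (h r hr (half_lt_self hr.1)).1).ne'

lemma ne_top {r : ℝ} (hr : r ∈ Ioc (0 : ℝ) 1) : a r ≠ ∞ := by
  obtain ⟨c, hc, h⟩ := ha.nondegenerate (r / 2) (half_pos hr.1)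
  exact ENNReal.inv_ne_zero.1
    ((ENNReal.ofReal_pos.2 hc).trans_le (h r hr (half_lt_self hr.1)).2).ne'

end IsZhikovProfile

open Classical in
/-- The profile, extended by `1` off `(0, 1]`, so that it is measurable on the whole line. This does
not change the weight. -/
def extendProfile (a : ℝ → ℝ≥0∞) : ℝ → ℝ≥0∞ := (Ioc (0 : ℝ) 1).piecewise a 1

lemma extendProfile_of_mem (a : ℝ → ℝ≥0∞) {r : ℝ} (hr : r ∈ Ioc (0 : ℝ) 1) :
    extendProfile a r = a r := piecewise_eq_of_mem _ _ _ hr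

lemma extendProfile_of_notMem (a : ℝ → ℝ≥0∞) {r : ℝ} (hr : r ∉ Ioc (0 : ℝ) 1) :
    extendProfile a r = 1 := piecewise_eq_of_notMem _ _ _ hr

lemma norm_mem_Ioc {x : Plane} (hx : x 0 * x 1 ≠ 0) (hx1 : ‖x‖ < 1) : ‖x‖ ∈ Ioc (0 : ℝ) 1 :=
  ⟨norm_pos_iff.2 fun h => hx (by simp [h]), hx1.le⟩

lemma zhikovWeight_extendProfile (a : ℝ → ℝ≥0∞) :
    zhikovWeight (extendProfile a) = zhikovWeight a := by
  ext x
  unfold zhikovWeight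
  split_ifs with h1 h2
  · rw [extendProfile_of_mem a (norm_mem_Ioc h1.1.ne' h1.2)]
  · rw [extendProfile_of_mem a (norm_mem_Ioc h2.1.ne h2.2)]
  · rfl

lemma zhikovWeight_eq_one (a : ℝ → ℝ≥0∞) {x : Plane} (hx : 1 ≤ ‖x‖) : zhikovWeight a x = 1 := by
  rw [zhikovWeight, if_neg fun h => h.2.not_ge hx, if_neg fun h => h.2.not_ge hx]

lemma zhikovWeight_cases (a : ℝ → ℝ≥0∞) (x : Plane) : zhikovWeight a x = 1 ∨
    ‖x‖ ∈ Ioc (0 : ℝ) 1 ∧ (zhikovWeight a x = a ‖x‖ ∨ zhikovWeight a x = (a ‖x‖)⁻¹) := by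
  unfold zhikovWeight
  split_ifs with h h'
  · exact Or.inr ⟨norm_mem_Ioc h.1.ne' h.2, Or.inr rfl⟩
  · exact Or.inr ⟨norm_mem_Ioc h'.1.ne h'.2, Or.inl rfl⟩
  · exact Or.inl rfl

namespace IsZhikovProfile

variable {a : ℝ → ℝ≥0∞} (ha : IsZhikovProfile a)
include ha

lemma measurable_extendProfile : Measurable (extendProfile a) := by
  refine measurable_of_restrict_of_restrict_compl (s := Ioc (0 : ℝ) 1) measurableSet_Ioc ?_ ?_
  · convert ha.measurable using 1
    ext r
    exact extendProfile_of_mem a r.2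
  · convert measurable_const (a := (1 : ℝ≥0∞)) using 1
    ext r
    exact extendProfile_of_notMem a r.2

lemma measurable_zhikovWeight : Measurable (zhikovWeight a) := by
  rw [← zhikovWeight_extendProfile]
  have hb := ha.measurable_extendProfile.comp (measurable_norm (α := Plane))
  have hm : Measurable fun x : Plane => x 0 * x 1 := by fun_prop
  exact Measurable.ite ((measurableSet_lt measurable_const hm).inter
    (measurableSet_lt measurable_norm measurable_const)) hb.inv
    (Measurable.ite ((measurableSet_lt hm measurable_const).inter
    (measurableSet_lt measurable_norm measurable_const)) hb measurable_const)

lemma lintegral_mul_lt_top :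
    ∫⁻ r in Ioc (0 : ℝ) 1, ENNReal.ofReal r * extendProfile a r < ∞ := by
  refine lt_of_le_of_lt (setLIntegral_mono' measurableSet_Ioc fun r hr => ?_) ha.integrable_div
  have h1 : ENNReal.ofReal r ≤ 1 := ENNReal.ofReal_le_one.2 hr.2
  rw [extendProfile_of_mem a hr, mul_comm, div_eq_mul_inv]
  gcongr
  -- `r ≤ 1 / r` on `(0, 1]`
  exact h1.trans (ENNReal.one_le_inv.2 h1)

lemma lintegral_mul_inv_lt_top :
    ∫⁻ r in Ioc (0 : ℝ) 1, ENNReal.ofReal r * (extendProfile a r)⁻¹ < ∞ := by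
  refine lt_of_le_of_lt (setLIntegral_mono' measurableSet_Ioc fun r hr => ?_) ha.integrable_inv
  rw [extendProfile_of_mem a hr, div_eq_mul_inv]

/-- A measurable function which takes values among `1`, `a(|x|)` and `1 / a(|x|)` is locally
integrable. -/
lemma locallyIntegrable_of_eq {w : Plane → ℝ≥0∞} (hw : Measurable w)
    (h : ∀ x, w x = 1 ∨ ‖x‖ ∈ Ioc (0 : ℝ) 1 ∧ (w x = a ‖x‖ ∨ w x = (a ‖x‖)⁻¹)) :
    LocallyIntegrable (fun x => (w x).toReal) volume := by
  have h1 := integrable_indicator_toReal_norm ha.measurable_extendProfile ha.lintegral_mul_lt_top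
  have h2 := integrable_indicator_toReal_norm ha.measurable_extendProfile.inv
    ha.lintegral_mul_inv_lt_top
  refine (((locallyIntegrable_const (1 : ℝ)).add h1.locallyIntegrable).add
    h2.locallyIntegrable).mono hw.ennreal_toReal.aestronglyMeasurable
    (Eventually.of_forall fun x => ?_)
  have hn : ∀ f : ℝ → ℝ≥0∞, 0 ≤ (Ioc (0 : ℝ) 1).indicator (fun r => (f r).toReal) ‖x‖ :=
    fun f => indicator_nonneg (fun _ _ => ENNReal.toReal_nonneg) _
  have hn1 := hn (extendProfile a)
  have hn2 := hn (extendProfile a)⁻¹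
  rw [Real.norm_of_nonneg ENNReal.toReal_nonneg]
  refine le_trans ?_ (le_abs_self _)
  change _ ≤ 1 + (Ioc (0 : ℝ) 1).indicator (fun r => (extendProfile a r).toReal) ‖x‖ +
    (Ioc (0 : ℝ) 1).indicator (fun r => ((extendProfile a)⁻¹ r).toReal) ‖x‖
  rcases h x with hx | ⟨hr, hx | hx⟩
  · rw [hx, ENNReal.toReal_one]
    linarith
  · rw [indicator_of_mem hr, extendProfile_of_mem a hr, hx]
    linarith
  · rw [indicator_of_mem (f := fun r => ((extendProfile a)⁻¹ r).toReal) hr, Pi.inv_apply,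
      extendProfile_of_mem a hr, hx]
    linarith

/-- Both the weight and its reciprocal are bounded by `1 + a(|x|) + 1 / a(|x|)` on the unit disc,
which is integrable. -/
theorem isAdmissibleWeight : IsAdmissibleWeight (zhikovWeight a) where
  measurable := ha.measurable_zhikovWeight
  ne_zero x := by
    rcases zhikovWeight_cases a x with h | ⟨hr, h | h⟩ <;> rw [h]
    · exact one_ne_zero
    · exact ha.ne_zero hr
    · exact ENNReal.inv_ne_zero.2 (ha.ne_top hr)
  ne_top x := by
    rcases zhikovWeight_cases a x with h | ⟨hr, h | h⟩ <;> rw [h]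
    · exact ENNReal.one_ne_top
    · exact ha.ne_top hr
    · exact ENNReal.inv_ne_top.2 (ha.ne_zero hr)
  locallyIntegrable := ha.locallyIntegrable_of_eq ha.measurable_zhikovWeight (zhikovWeight_cases a)
  locallyIntegrable_inv := ha.locallyIntegrable_of_eq ha.measurable_zhikovWeight.inv fun x => by
    rcases zhikovWeight_cases a x with h | ⟨hr, h | h⟩
    · exact Or.inl (by simp [h])
    · exact Or.inr ⟨hr, Or.inr (by simp [h])⟩
    · exact Or.inr ⟨hr, Or.inl (by simp [h])⟩

end IsZhikovProfile

end Weight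

end

theorem mainTheorem11 (a : ℝ → ℝ≥0∞) (ha : IsZhikovProfile a) :
    (IsLocallyFiniteMeasure (zhikovMeasure a) ∧ (zhikovMeasure a).IsOpenPosMeasure) ∧
    IsDirichletForm (sobolevH (zhikovMeasure a)) (energy (zhikovMeasure a)) ∧
    IsRegularForm (sobolevH (zhikovMeasure a)) (energy (zhikovMeasure a)) ∧
    IsStronglyLocalForm (sobolevH (zhikovMeasure a)) (energy (zhikovMeasure a)) ∧
    IsRecurrentForm (sobolevH (zhikovMeasure a)) (energy (zhikovMeasure a)) ∧
    IsConservativeForm (sobolevH (zhikovMeasure a)) (energy (zhikovMeasure a)) := by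
  have hρ := ha.isAdmissibleWeight
  have hF := hρ.isFormOf
  have hM := hρ.isMarkovianForm
  have : IsFiniteMeasureOnCompacts (weightedMeasure (zhikovWeight a)) :=
    hρ.isFiniteMeasureOnCompacts
  obtain ⟨u, hu⟩ := hρ.exists_isUnitApproximation fun x hx => (zhikovWeight_eq_one a hx).le
  exact ⟨⟨isLocallyFiniteMeasure_of_isFiniteMeasureOnCompacts
      (μ := weightedMeasure (zhikovWeight a)),
    hρ.volume_absolutelyContinuous.isOpenPosMeasure⟩,
    ⟨hF.isSymmetricForm, hF.isClosedForm, hM⟩, hρ.isRegularForm, hρ.isStronglyLocalForm,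
    hF.isRecurrentForm hM hu, hF.isConservativeForm hM hu⟩
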